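/- Conventions. All parameter sets are countable, "definable" allows parameters but no imaginary sorts, and powers $K^n$ carry the product topology. A structure $\mathcal K$ is geometric if in every model of its theory $\operatorname{acl}$ satisfies exchange and for each formula $\varphi(x,\bar y)$ with $x$ a single variable the set $\{\bar b:\varphi(x,\bar b)\text{ has finitely many solutions}\}$ is definable. Then $\dim(a/A)$ is the length of a maximal $\operatorname{acl}$-independent over $A$ subtuple of the finite tuple $a$; for $X$ definable over $A$, $\dim(X)=\max\{\dim(a/A):a\in X\}$, and $a\in X$ is generic in $X$ over $A$ if $\dim(a/A)=\dim(X)$; $a,b$ are independent over $A$ if $\dim(a/Ab)=\dim(a/A)$. Let $\mathcal K=(K,\dots)$ be a structure with a topology $\tau$ on $K$ such that $(\mathcal K,\tau)$ is a Hausdorff geometric structure, that is: (1) $\tau$ is Hausdorff; (2) $\mathcal K$ is geometric and $\aleph_1$-saturated; (3) if $X\subseteq K^n$ is definable over $A$ and $a\in\overline{\overline X\setminus X}$, then $\dim(a/A)<\dim(X)$; (4) if $X\subseteq K^n$ is definable over $A$, $a\in X$ is generic over $A$ and $B\supseteq A$ is countable, then every neighborhood of $a$ contains a generic of $X$ over $B$;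 (5) if $X$, $Y$ and $Z\subseteq X\times Y$ are definable over $A$ and of the same dimension, the projections $Z\to X$ and $Z\to Y$ are finite-to-one, and $(x,y)$ is generic in $Z$ over $A$, then there are open neighborhoods $U$ of $x$ in $X$ and $V$ of $y$ in $Y$ such that $Z\cap(U\times V)$ is the graph of a homeomorphism $U\to V$. Intersections. Let $\mathcal Y=\{Y_t:t\in T\}$ and $\mathcal Z=\{Z_u:u\in U\}$ be $A$-definable families (with graphs $Y\subseteq X\times T$, $Z\subseteq X\times U$) of subsets of an $A$-definable set $X$. A weakly generic $(\mathcal Y,\mathcal Z)$-intersection over $A$ is a tuple $(x,t,u)$ such that $x\in X$, $t\in T$, $u\in U$, $(x,t)\in Y$, $(x,u)\in Z$ are all generic over $A$. It is strongly generic if moreover $t,u$ are independent over both $A$ and $Ax$; it is strongly approximable if each of its neighborhoods contains a strongly generic $(\mathcal Y,\mathcal Z)$-intersection over $A$. Its codimension over $A$ is $\dim(t/Ax)+\dim(u/Ax)-\dim(tu/Ax)$. It is a generic multiple intersection over $A$ if, with $I=\{(x',t',u'):x'\in Y_{t'}\cap Z_{u'}\}$ and $f:I\to T\times U$ the projection,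 $((x,t,u),(x,t,u))$ lies in the closure of $\{(p,p')\in I^2:p\ne p',\ f(p)=f(p')\}$. $(\mathcal K,\tau)$ has ramification purity if for all such $A,X,\mathcal Y,\mathcal Z$: if there is a generic multiple $(\mathcal Y,\mathcal Z)$-intersection over $A$ that is strongly approximable over $A$, then there is a generic multiple $(\mathcal Y,\mathcal Z)$-intersection over $A$ of codimension at most $1$ over $A$. Relics. Let $A_0\subseteq K$ be countable, and let $\mathcal M=(M,\dots)$ be a structure, in any language, with $M\subseteq K^d$ for some $d$, such that $M$ and all $\emptyset$-definable sets of $\mathcal M$ are definable in $\mathcal K$ over $A_0$ (a definable $\mathcal K$-relic). Suppose that $\mathcal M$ is strongly minimal (infinite, and in every elementary extension of $\mathcal M$ each definable subset of the universe is finite or cofinite), and write $\operatorname{rk}$ for the dimension, defined as above, in the sense of $\mathcal M$. A plane curve is a definable subset of $M^2$ of rank $1$. A definable family $\{C_t:t\in T\}$ of plane curves, $T\subseteq M^n$, is almost faithful if for each $t\in T$ there are only finitely many $t'\in T$ with $\operatorname{rk}(C_t\cap C_{t'})=1$. $\mathcal M$ is non-locally modular if it has a definable almost faithful family of plane curves with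 $\operatorname{rk}(T)=2$. A standard family over a countable $A\subseteq M$ is an $\mathcal M$-definable over $A$ almost faithful family of plane curves $\{C_t:t\in T\}$ with $T\subseteq M^n$, $\operatorname{rk}(T)=n\ge 1$, and $\operatorname{rk}\{t\in T:x\in C_t\}\le n-1$ for all $x\in M^2$. $\mathcal M$ detects multiple intersections if, whenever $\mathcal C$ and $\mathcal D$ are standard families over a countable $A\subseteq M$ and $(x,t,u)$ is a generic multiple $(\mathcal C,\mathcal D)$-intersection over $A_0\cup A$ in the sense of $(\mathcal K,\tau)$ (with ambient set $M^2$), then $t$ and $u$ are dependent over $A$ in the sense of $\mathcal M$. Theorem. Let $(\mathcal K,\tau)$ be a Hausdorff geometric structure with ramification purity, and let $\mathcal M$ be a non-locally modular strongly minimal definable $\mathcal K$-relic (definable over a countable $A_0$) that detects multiple intersections. Then $\dim(M)=1$ in the sense of $\mathcal K$. -/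

import Mathlib

open FirstOrder FirstOrder.Language Set Topology

universe u v u' v' w

namespace ModelDim

/-! ### Algebraic closure, dimension, genericity, independence in a first-order structure -/

section General

variable (L : FirstOrder.Language.{u, v}) {K : Type w} [L.Structure K]

/-- Model-theoretic algebraic closure: the elements lying in a finite `A`-definable set. -/
def acl (A : Set K) : Set K :=
  {a | ∃ S : Set K, A.Definable₁ L S ∧ S.Finite ∧ a ∈ S}

/-- The subtuple of `a` indexed by `s` is `acl`-independent over `A`. -/
def AclIndep {ι : Type} (A : Set K) (a : ι → K) (s : Finset ι) : Prop :=
  ∀ i ∈ s, a i ∉ acl L (A ∪ a '' {j | j ∈ s ∧ j ≠ i})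

/-- `dim(a/A)` for a finite tuple `a`: the largest length of a subtuple that is
`acl`-independent over `A`. In a strongly minimal structure this is the Morley rank. -/
noncomputable def tupleDim {ι : Type} (A : Set K) (a : ι → K) : ℕ :=
  sSup {n | ∃ s : Finset ι, AclIndep L A a s ∧ s.card = n}

/-- `max {dim(x/A) : x ∈ X}` (and `0` for the empty set). -/
noncomputable def dimOver {ι : Type} (A : Set K) (X : Set (ι → K)) : ℕ :=
  sSup {n | ∃ x ∈ X, tupleDim L A x = n}

/-- The dimension of a definable set `X`: the number `dimOver L A X` for any countable `A` over
which `X` is definable. In an `ℵ₁`-saturated geometric structure it does not depend on `A`, so that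
the infimum is over a one-element set. -/
noncomputable def setDim {ι : Type} (X : Set (ι → K)) : ℕ :=
  sInf {n | ∃ A : Set K, A.Countable ∧ A.Definable L X ∧ dimOver L A X = n}

/-- `x` is a generic point of `X` over `A`. -/
def IsGeneric {ι : Type} (A : Set K) (X : Set (ι → K)) (x : ι → K) : Prop :=
  x ∈ X ∧ tupleDim L A x = setDim L X

/-- The tuple `a` is independent from the tuple `b` over `A`. -/
def Independent {ι κ : Type} (A : Set K) (a : ι → K) (b : κ → K) : Prop :=
  tupleDim L (A ∪ range b) a = tupleDim L A a

variable (K)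

/-- Every family of `A`-definable subsets of a finite power of `K`, with `A` countable, that has the
finite intersection property has a common point: all types over countable sets are realized. -/
def IsAleph1Saturated : Prop :=
  ∀ (ι : Type) [Finite ι] (A : Set K), A.Countable →
    ∀ F : Set (Set (ι → K)), (∀ S ∈ F, A.Definable L S) →
      (∀ G : Finset (Set (ι → K)), (G : Set (Set (ι → K))) ⊆ F →
        (⋂₀ (G : Set (Set (ι → K)))).Nonempty) →
      (⋂₀ F).Nonempty

/-- `acl` has the exchange property in `K`. -/
def HasExchange : Prop :=
  ∀ (A : Set K) (b c : K), c ∈ acl L (insert b A) → c ∉ acl L A → b ∈ acl L (insert c A)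

/-- In `K`, finiteness of the fibres of a formula is a definable condition. -/
def ElimExistsInfinity : Prop :=
  ∀ (n : ℕ) (φ : L.Formula (Fin (n + 1))),
    (univ : Set K).Definable L
      {b : Fin n → K | {a : K | φ.Realize (Fin.cons a b : Fin (n + 1) → K)}.Finite}

/-- The complete theory of `K` is geometric. -/
def IsGeometric : Prop :=
  ∀ (N : Type w) [L.Structure N], (K ≅[L] N) → HasExchange L N ∧ ElimExistsInfinity L N

/-- `K` is infinite and in every elementary extension of `K`, every set definable
with parameters is finite or cofinite. -/
def IsStronglyMinimal : Prop :=
  Infinite K ∧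
  ∀ (N : Type w) [L.Structure N], Nonempty (K ↪ₑ[L] N) →
    ∀ S : Set N, (univ : Set N).Definable₁ L S → S.Finite ∨ Sᶜ.Finite

end General

/-! ### Families of plane curves in a strongly minimal structure -/

section PlaneCurves

variable (L : FirstOrder.Language.{u, v}) {M : Type w} [L.Structure M]

/-- The member `C_t` of the family with graph `C`. -/
def fiber {ι κ : Type} (C : Set (ι ⊕ κ → M)) (t : κ → M) : Set (ι → M) :=
  {x | Sum.elim x t ∈ C}

/-- `{C_t : t ∈ T}`, with graph `C`, is an `A`-definable family of subsets of `X`. -/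
structure IsDefinableFamily {ι κ : Type} (A : Set M) (X : Set (ι → M)) (T : Set (κ → M))
    (C : Set (ι ⊕ κ → M)) : Prop where
  definable_params : A.Definable L T
  definable_graph : A.Definable L C
  subset : ∀ (x : ι → M) (t : κ → M), Sum.elim x t ∈ C → x ∈ X ∧ t ∈ T

/-- `{C_t : t ∈ T}` is an `A`-definable almost faithful family of plane curves. -/
structure IsAlmostFaithfulCurves {n : ℕ} (A : Set M) (T : Set (Fin n → M))
    (C : Set (Fin 2 ⊕ Fin n → M)) : Prop where
  family : IsDefinableFamily L A univ T C
  curve : ∀ t ∈ T, setDim L (fiber C t) = 1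
  almost_faithful : ∀ t ∈ T, {t' ∈ T | setDim L (fiber C t ∩ fiber C t') = 1}.Finite

/-- A standard family of plane curves over `A`: almost faithful, with parameter set a
generic subset of `M ^ n`, `n ≥ 1`, only a non-generic part of which belongs to curves through
a given point. -/
structure IsStandardFamily {n : ℕ} (A : Set M) (T : Set (Fin n → M))
    (C : Set (Fin 2 ⊕ Fin n → M)) : Prop extends IsAlmostFaithfulCurves L A T C where
  one_le : 1 ≤ n
  rank_eq : setDim L T = n
  rank_through : ∀ x : Fin 2 → M, setDim L {t | Sum.elim x t ∈ C} < n

variable (M)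

/-- There is a definable almost faithful family of plane curves of rank 2 (for `M` strongly minimal
and `ℵ₁`-saturated, so that the rank of a definable set is read off from its points). -/
def IsNonLocallyModular : Prop :=
  ∃ (A : Set M) (n : ℕ) (T : Set (Fin n → M)) (C : Set (Fin 2 ⊕ Fin n → M)),
    A.Countable ∧ IsAlmostFaithfulCurves L A T C ∧ setDim L T = 2

end PlaneCurves

/-! ### Hausdorff geometric structures -/

section Topological

variable (L : FirstOrder.Language.{u, v}) (K : Type w) [L.Structure K] [TopologicalSpace K]

/-- Hausdorff geometric structures. Powers of `K` carry the product topology, and parameter sets are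
countable. The frontier of `X` is `closure X \ X`. -/
structure IsHausdorffGeometric : Prop where
  hausdorff : T2Space K
  geometric : IsGeometric L K
  saturated : IsAleph1Saturated L K
  strong_frontier : ∀ (ι : Type) [Finite ι] (A : Set K) (X : Set (ι → K)) (a : ι → K),
    A.Countable → A.Definable L X → a ∈ closure (closure X \ X) →
      tupleDim L A a < setDim L X
  baire : ∀ (ι : Type) [Finite ι] (A B : Set K) (X : Set (ι → K)) (a : ι → K),
    A.Countable → B.Countable → A ⊆ B → A.Definable L X → IsGeneric L A X a →
      ∀ U ∈ 𝓝 a, ∃ b ∈ U, IsGeneric L B X b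
  generic_local_homeo : ∀ (ι κ : Type) [Finite ι] [Finite κ] (A : Set K)
    (X : Set (ι → K)) (Y : Set (κ → K)) (Z : Set (ι ⊕ κ → K)) (x : ι → K) (y : κ → K),
    A.Countable → A.Definable L X → A.Definable L Y → A.Definable L Z →
    (∀ a b, Sum.elim a b ∈ Z → a ∈ X ∧ b ∈ Y) →
    setDim L X = setDim L Z → setDim L Y = setDim L Z →
    (∀ a, {b | Sum.elim a b ∈ Z}.Finite) → (∀ b, {a | Sum.elim a b ∈ Z}.Finite) →
    IsGeneric L A Z (Sum.elim x y) →
    ∃ (U : Set (ι → K)) (V : Set (κ → K)), IsOpen U ∧ IsOpen V ∧ x ∈ U ∧ y ∈ V ∧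
      ∃ e : ↥(X ∩ U) ≃ₜ ↥(Y ∩ V), ∀ (a : ↥(X ∩ U)) (b : ↥(Y ∩ V)),
        Sum.elim (a : ι → K) (b : κ → K) ∈ Z ↔ e a = b

/-- `p` is a topological ramification point of the restriction of `f` to `X`: it is in `X`, and
`(p, p)` is in the closure of the set of pairs of distinct points of `X` with the same image. -/
def IsTopRamificationPoint {P Q : Type*} [TopologicalSpace P] (X : Set P) (f : P → Q) (p : P) :
    Prop :=
  p ∈ X ∧ (p, p) ∈ closure {q : P × P | q.1 ∈ X ∧ q.2 ∈ X ∧ q.1 ≠ q.2 ∧ f q.1 = f q.2}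

variable {K} {ι κ μ : Type}

/-- `(x, t, u)` is a weakly generic intersection over `A` of the families
`{Y_t : t ∈ T}` and `{Z_u : u ∈ U}` of subsets of `X`. -/
structure IsWeaklyGeneric (A : Set K) (X : Set (ι → K)) (T : Set (κ → K)) (U : Set (μ → K))
    (Y : Set (ι ⊕ κ → K)) (Z : Set (ι ⊕ μ → K)) (x : ι → K) (t : κ → K) (u : μ → K) : Prop where
  point : IsGeneric L A X x
  left_param : IsGeneric L A T t
  right_param : IsGeneric L A U u
  left : IsGeneric L A Y (Sum.elim x t)
  right : IsGeneric L A Z (Sum.elim x u)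

/-- A weakly generic intersection with `t` and `u` independent over both `A` and `Ax`. -/
structure IsStronglyGeneric (A : Set K) (X : Set (ι → K)) (T : Set (κ → K)) (U : Set (μ → K))
    (Y : Set (ι ⊕ κ → K)) (Z : Set (ι ⊕ μ → K)) (x : ι → K) (t : κ → K) (u : μ → K) : Prop
    extends IsWeaklyGeneric L A X T U Y Z x t u where
  indep : Independent L A t u
  indep_point : Independent L (A ∪ range x) t u

/-- A weakly generic intersection, every neighbourhood of which contains a strongly generic one. -/
def IsStronglyApproximable (A : Set K) (X : Set (ι → K)) (T : Set (κ → K)) (U : Set (μ → K))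
    (Y : Set (ι ⊕ κ → K)) (Z : Set (ι ⊕ μ → K)) (x : ι → K) (t : κ → K) (u : μ → K) : Prop :=
  IsWeaklyGeneric L A X T U Y Z x t u ∧
  ∀ W ∈ 𝓝 ((x, t, u) : (ι → K) × (κ → K) × (μ → K)),
    ∃ p ∈ W, IsStronglyGeneric L A X T U Y Z p.1 p.2.1 p.2.2

/-- A weakly generic intersection that is a topological ramification point of the projection
`I → T × U`, with `I` the set of all `(x', t', u')` such that `x'` is in `Y_t'` and in `Z_u'`. -/
def IsGenericMultiple (A : Set K) (X : Set (ι → K)) (T : Set (κ → K)) (U : Set (μ → K))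
    (Y : Set (ι ⊕ κ → K)) (Z : Set (ι ⊕ μ → K)) (x : ι → K) (t : κ → K) (u : μ → K) : Prop :=
  IsWeaklyGeneric L A X T U Y Z x t u ∧
  IsTopRamificationPoint
    {p : (ι → K) × (κ → K) × (μ → K) | Sum.elim p.1 p.2.1 ∈ Y ∧ Sum.elim p.1 p.2.2 ∈ Z}
    Prod.snd (x, t, u)

/-- The codimension of `(x, t, u)` over `A`: `dim(t/Ax) + dim(u/Ax) - dim(tu/Ax)`. -/
noncomputable def codim (A : Set K) (x : ι → K) (t : κ → K) (u : μ → K) : ℤ :=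
  tupleDim L (A ∪ range x) t + tupleDim L (A ∪ range x) u
    - tupleDim L (A ∪ range x) (Sum.elim t u)

variable (K)

/-- Ramification purity. -/
def HasRamificationPurity : Prop :=
  ∀ (ι κ μ : Type) [Finite ι] [Finite κ] [Finite μ] (A : Set K) (X : Set (ι → K))
    (T : Set (κ → K)) (U : Set (μ → K)) (Y : Set (ι ⊕ κ → K)) (Z : Set (ι ⊕ μ → K)),
    A.Countable → A.Definable L X →
    IsDefinableFamily L A X T Y → IsDefinableFamily L A X U Z →
    (∃ x t u, IsGenericMultiple L A X T U Y Z x t u ∧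
      IsStronglyApproximable L A X T U Y Z x t u) →
    ∃ x t u, IsGenericMultiple L A X T U Y Z x t u ∧ codim L A x t u ≤ 1

end Topological

/-! ### Definable relics -/

section Relics

variable (L : FirstOrder.Language.{u, v}) {K : Type w} [L.Structure K]

/-- A tuple of elements of `M ⊆ K ^ d`, as a tuple of elements of `K`. -/
def flat {d : ℕ} {M : Set (Fin d → K)} {ι : Type} (x : ι → M) : ι × Fin d → K :=
  fun p => (x p.1 : Fin d → K) p.2

/-- A subset of `(M ^ ι) × (M ^ κ)`, seen inside a power of `K`. -/
def flatGraph {d : ℕ} {M : Set (Fin d → K)} {ι κ : Type} (C : Set (ι ⊕ κ → M)) :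
    Set ((ι × Fin d) ⊕ (κ × Fin d) → K) :=
  {z | ∃ (x : ι → M) (t : κ → M), Sum.elim x t ∈ C ∧ z = Sum.elim (flat x) (flat t)}

/-- The set of all coordinates of the elements of `A ⊆ M ⊆ K ^ d`. -/
def coords {d : ℕ} {M : Set (Fin d → K)} (A : Set M) : Set K :=
  {k | ∃ a ∈ A, ∃ i, k = (a : Fin d → K) i}

/-- The structure `M`, with universe a subset of `K ^ d`, is a relic of `K` that is definable over
`A₀`: the universe and all sets `∅`-definable in `M` are definable in `K` over `A₀`. -/
structure IsDefinableRelic (A₀ : Set K) {d : ℕ} (M : Set (Fin d → K))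
    (L' : FirstOrder.Language.{u', v'}) [L'.Structure M] : Prop where
  definable_universe : A₀.Definable L M
  definable_of_definable : ∀ (n : ℕ) (S : Set (Fin n → M)), (∅ : Set M).Definable L' S →
    A₀.Definable L (flat '' S)

variable [TopologicalSpace K]

/-- `M`, a relic of `K` definable over `A₀`, detects multiple intersections: if `C` and `D` are
standard families of plane curves over a countable `A ⊆ M`, and `(x, t, u)` is a generic
multiple intersection of them over `A` in the sense of `K` with constants for `A₀` added,
then `t` and `u` are dependent over `A` in the sense of `M`. -/
def DetectsMultipleIntersections (A₀ : Set K) {d : ℕ} (M : Set (Fin d → K))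
    (L' : FirstOrder.Language.{u', v'}) [L'.Structure M] : Prop :=
  ∀ (A : Set M) (n m : ℕ) (T : Set (Fin n → M)) (U : Set (Fin m → M))
    (C : Set (Fin 2 ⊕ Fin n → M)) (D : Set (Fin 2 ⊕ Fin m → M)),
    A.Countable → IsStandardFamily L' A T C → IsStandardFamily L' A U D →
    ∀ (x : Fin 2 → M) (t : Fin n → M) (u : Fin m → M),
      IsGenericMultiple L (A₀ ∪ coords A) (range (flat : (Fin 2 → M) → Fin 2 × Fin d → K))
        (flat '' T) (flat '' U) (flatGraph C) (flatGraph D) (flat x) (flat t) (flat u) →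
      ¬ Independent L' A t u

end Relics

end ModelDim

namespace ModelDim

/-! ### Definable sets -/

section Definability

variable {L : FirstOrder.Language.{u, v}} {K : Type w} [L.Structure K]

/-! Write δ for the dimension of `M` in `K` and rk for rank in `M`. Since `M` is infinite, δ ≥ 1.
The bridge between the two dimensions is `IsMinimalRelic.setDim_image_flat`: a set of rank r in `M`
has dimension rδ in `K`. For tuples only one inequality survives, dim(a) ≤ δ · rk(a)
(`IsMinimalRelic.tupleDim_flat_le`), and it serves to bound ranks from below.

Non-local modularity yields a standard family C with parameters in the plane
(`IsNonLocallyModular.exists_isStandardFamily`). Intersect C with itself and let (x, t) be generic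
in its graph, which has dimension 3δ. The diagonal point (x, t, t) is a generic multiple
intersection, because C_t meets itself in all of C_t and x is not isolated there. It is strongly
approximable, because t is a limit of parameters u of curves through x that are independent from t
over x. Ramification purity therefore provides a generic multiple intersection (x, t, u), no longer
on the diagonal in general, of codimension at most 1.

Suppose δ ≥ 2. Then dim(tu/Ax) ≥ 2δ - 1 > δ, so rk(tu/Ax) ≥ 2. By almost faithfulness C_t and C_u
have finite intersection (`IsStandardFamily.range_subset_acl`), so x is algebraic over t and u, and
rk(tu/A) ≥ rk(x/A) + rk(tu/Ax) ≥ 2 + 2. As t and u lie in the plane, they are independent, contrary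
to detection of multiple intersections. -/

theorem definable_fiber {ι κ : Type} {A : Set K} {C : Set (ι ⊕ κ → K)} (hC : A.Definable L C)
    (t : κ → K) : (A ∪ range t).Definable L (fiber C t) := by
  obtain ⟨φ, rfl⟩ := definable_iff_exists_formula_sum.1 hC
  refine definable_iff_exists_formula_sum.2 ⟨φ.relabel (Sum.elim
    (fun a : A => Sum.inl ⟨a, Or.inl a.2⟩)
    (Sum.elim Sum.inr fun k => Sum.inl ⟨t k, Or.inr ⟨k, rfl⟩⟩)), ?_⟩
  ext x
  simp only [fiber, mem_ofPred_eq, Formula.realize_relabel]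
  refine iff_of_eq (congrArg _ ?_)
  funext z
  rcases z with a | i | k <;> rfl

/-- The constants naming entries of `t` become variables; one that also lies in `A` stays a
constant. -/
theorem exists_fiber_of_definable {ι κ : Type} {A : Set K} {t : κ → K} {S : Set (ι → K)}
    (hS : (A ∪ range t).Definable L S) :
    ∃ G : Set (ι ⊕ κ → K), A.Definable L G ∧ fiber G t = S := by
  classical
  obtain ⟨φ, rfl⟩ := definable_iff_exists_formula_sum.1 hS
  have hc : ∀ c : ↥(A ∪ range t), (c : K) ∉ A → ∃ k, t k = c := fun c hc => c.2.resolve_left hc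
  let f : ↥(A ∪ range t) ⊕ ι → A ⊕ (ι ⊕ κ) := Sum.elim
    (fun c => if h : (c : K) ∈ A then Sum.inl ⟨c, h⟩ else Sum.inr (Sum.inr (hc c h).choose))
    (fun i => Sum.inr (Sum.inl i))
  refine ⟨_, definable_iff_exists_formula_sum.2 ⟨φ.relabel f, rfl⟩, ?_⟩
  ext x
  simp only [fiber, mem_ofPred_eq, Formula.realize_relabel]
  refine iff_of_eq (congrArg _ ?_)
  funext z
  rcases z with c | i
  · by_cases h : (c : K) ∈ A
    · simp [f, h]
    · simp [f, h, (hc c h).choose_spec]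
  · simp [f]

theorem definable_eq {ι : Type} (A : Set K) (i j : ι) :
    A.Definable L {x : ι → K | x i = x j} :=
  (Definable.diagonal L A).preimage_comp ![i, j]

theorem definable_preimage₁ {ι : Type} {A : Set K} {S : Set K} (hS : A.Definable₁ L S) (i : ι) :
    A.Definable L {x : ι → K | x i ∈ S} :=
  Definable.preimage_comp (fun _ : Fin 1 => i) hS

theorem natCast_le_encard_iff {α : Type*} {s : Set α} {n : ℕ} :
    (n : ℕ∞) ≤ s.encard ↔ ∃ f : Fin n → α, Function.Injective f ∧ ∀ i, f i ∈ s := by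
  constructor
  · intro h
    obtain ⟨t, hts, ht⟩ := exists_subset_encard_eq h
    have hf : t.Finite := finite_of_encard_eq_coe ht
    have : t.ncard = n := by rw [ncard, ht]; rfl
    have := hf.to_subtype
    let e : Fin n ≃ t := (Finite.equivFinOfCardEq (by rwa [Nat.card_coe_set_eq])).symm
    exact ⟨fun i => e i, Subtype.val_injective.comp e.injective, fun i => hts (e i).2⟩
  · rintro ⟨f, hf, hs⟩
    calc (n : ℕ∞) = (range f).encard := by
          rw [← image_univ, hf.encard_image]; simp
      _ ≤ s.encard := encard_le_encard (range_subset_iff.2 hs)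

/-- The n distinct points of the fibre are quantified as a single block of variables indexed by `Fin
n × ι`. -/
theorem definable_le_encard_fiber {ι κ : Type} [Finite ι] {A : Set K} {G : Set (ι ⊕ κ → K)}
    (hG : A.Definable L G) (n : ℕ) :
    A.Definable L {t : κ → K | (n : ℕ∞) ≤ (fiber G t).encard} := by
  have h1 : A.Definable L {w : κ ⊕ (Fin n × ι) → K |
      ∀ i : Fin n, Sum.elim (fun k => w (Sum.inr (i, k))) (w ∘ Sum.inl) ∈ G} := by
    simp only [ofPred_forall]
    refine definable_iInter_of_finite fun i => ?_
    have := hG.preimage_comp (Sum.elim (fun k => Sum.inr (i, k)) Sum.inl :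
      ι ⊕ κ → κ ⊕ (Fin n × ι))
    convert this using 1
    ext w
    simp only [mem_ofPred_eq, mem_preimage]
    refine iff_of_eq (congrArg (· ∈ G) ?_)
    funext z
    rcases z with z | z <;> rfl
  have h2 : A.Definable L {w : κ ⊕ (Fin n × ι) → K |
      ∀ p : {p : Fin n × Fin n // p.1 ≠ p.2},
        ∃ k, w (Sum.inr (p.1.1, k)) ≠ w (Sum.inr (p.1.2, k))} := by
    simp only [ofPred_forall]
    refine definable_iInter_of_finite fun p => ?_
    simp only [ofPred_exists]
    exact definable_iUnion_of_finite fun k => (definable_eq A _ _).compl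
  convert (h1.inter h2).exists_of_finite using 1
  ext t
  simp only [mem_ofPred_eq, natCast_le_encard_iff, mem_inter_iff]
  constructor
  · rintro ⟨f, hf, hs⟩
    refine ⟨fun p => f p.1 p.2, fun i => hs i, fun p => ?_⟩
    by_contra! h
    exact p.2 (hf (funext h))
  · rintro ⟨v, h1, h2⟩
    refine ⟨fun i k => v (i, k), fun i j hij => ?_, fun i => h1 i⟩
    by_contra hne
    obtain ⟨k, hk⟩ := h2 ⟨(i, j), hne⟩
    exact hk (congrFun hij k)

theorem definable_encard_fiber_le {ι κ : Type} [Finite ι] {A : Set K} {G : Set (ι ⊕ κ → K)}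
    (hG : A.Definable L G) (n : ℕ) :
    A.Definable L {t : κ → K | (fiber G t).encard ≤ n} := by
  convert (definable_le_encard_fiber hG (n + 1)).compl using 1
  ext t
  simp only [mem_ofPred_eq, mem_compl_iff, not_le]
  rw [Nat.cast_add, Nat.cast_one, ENat.lt_add_one_iff (by simp)]

theorem exists_fin_range_eq {X : Set K} (hX : X.Finite) :
    ∃ (n : ℕ) (b : Fin n → K), range b = X := by
  obtain ⟨n, b, -, hb⟩ := hX.fin_param
  exact ⟨n, b, hb⟩

theorem exists_tuple_of_definable {ι : Type} {A : Set K} {S : Set (ι → K)}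
    (hS : A.Definable L S) : ∃ (n : ℕ) (b : Fin n → K) (G : Set (ι ⊕ Fin n → K)),
      range b ⊆ A ∧ (∅ : Set K).Definable L G ∧ fiber G b = S := by
  obtain ⟨A1, hA1, hS1⟩ := definable_iff_finitely_definable.1 hS
  obtain ⟨n, b, hb⟩ := exists_fin_range_eq A1.finite_toSet
  rw [← hb] at hS1 hA1
  obtain ⟨G, hG, h⟩ := exists_fiber_of_definable (A := ∅) (t := b) (by simpa using hS1)
  exact ⟨n, b, G, hA1, hG, h⟩

end Definability

/-! ### Algebraic closure -/

section Closure

variable {L : FirstOrder.Language.{u, v}} {K : Type w} [L.Structure K]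

theorem acl_mono {A B : Set K} (h : A ⊆ B) : acl L A ⊆ acl L B :=
  fun _ ⟨S, hS, hf, ha⟩ => ⟨S, hS.mono h, hf, ha⟩

theorem subset_acl (A : Set K) : A ⊆ acl L A :=
  fun a ha => ⟨{a}, Definable.singleton_of_mem L ha, finite_singleton a, rfl⟩

theorem mem_acl_of_finite {ι : Type} [Finite ι] {A : Set K} {S : Set (ι → K)}
    (hS : A.Definable L S) (hf : S.Finite) {x : ι → K} (hx : x ∈ S) (i : ι) :
    x i ∈ acl L A := by
  refine ⟨(fun y => y i) '' S, ?_, hf.image _, ⟨x, hx, rfl⟩⟩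
  have h := hS.image_comp (fun _ : Fin 1 => i)
  rw [Definable₁]
  convert h using 1
  ext y
  simp only [mem_image, mem_ofPred_eq]
  refine exists_congr fun z => and_congr_right fun _ => ?_
  constructor
  · intro h
    funext j
    rw [Subsingleton.elim j 0]
    exact h
  · rintro rfl
    rfl

theorem mem_acl_union_range_iff {κ : Type} {A : Set K} {b : κ → K} {c : K} :
    c ∈ acl L (A ∪ range b) ↔ ∃ G : Set (Fin 1 ⊕ κ → K), A.Definable L G ∧
      (fiber G b).Finite ∧ (fun _ => c) ∈ fiber G b := by
  constructor
  · rintro ⟨S, hS, hf, hc⟩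
    obtain ⟨G, hG, h⟩ := exists_fiber_of_definable hS
    refine ⟨G, hG, ?_, ?_⟩
    · rw [h]
      exact hf.preimage (Equiv.funUnique (Fin 1) K).injective.injOn
    · rw [h]
      exact hc
  · rintro ⟨G, hG, hf, hc⟩
    exact mem_acl_of_finite (definable_fiber hG b) hf hc 0

/-- If c is one of N solutions of a formula over a tuple b algebraic over `A`, confine b to finite
`A`-definable sets and demand at most N solutions. The pairs (c, b) then form a finite `A`-definable
set. -/
theorem acl_acl (A : Set K) : acl L (acl L A) = acl L A := by
  refine Subset.antisymm ?_ (subset_acl _)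
  rintro c ⟨S, hS, hf, hc⟩
  obtain ⟨n, b, G, hb, hG, hGS⟩ := exists_tuple_of_definable hS
  have hfin : (fiber G b).Finite := by
    rw [hGS]
    exact hf.preimage (Equiv.funUnique (Fin 1) K).injective.injOn
  obtain ⟨N, hN⟩ : ∃ N : ℕ, (fiber G b).encard = N := ⟨_, hfin.cast_ncard_eq.symm⟩
  choose T hT hTf hTb using fun i => hb (mem_range_self i)
  let W : Set (Fin 1 ⊕ Fin n → K) := G ∩ ({w | (w ∘ Sum.inr) ∈ {t | (fiber G t).encard ≤ N}} ∩
    ⋂ i, {w | w (Sum.inr i) ∈ T i})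
  have hW : A.Definable L W :=
    (hG.mono (empty_subset _)).inter
      ((((definable_encard_fiber_le hG N).mono (empty_subset _)).preimage_comp Sum.inr).inter
        (definable_iInter_of_finite fun i => definable_preimage₁ (hT i) _))
  have hWf : W.Finite := by
    have : (⋃ t ∈ {t | (∀ i, t i ∈ T i) ∧ (fiber G t).encard ≤ N},
        (fun y => Sum.elim y t) '' fiber G t).Finite := by
      refine Finite.biUnion ((Finite.pi' hTf).subset fun t ht => ht.1) fun t ht => ?_
      exact (finite_of_encard_le_coe ht.2).image _
    refine this.subset fun w hw => ?_
    simp only [mem_iUnion]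
    refine ⟨w ∘ Sum.inr, ⟨fun i => mem_iInter.1 hw.2.2 i, hw.2.1⟩, w ∘ Sum.inl, ?_,
      Sum.elim_comp_inl_inr w⟩
    simpa [fiber, Sum.elim_comp_inl_inr] using hw.1
  have hcW : Sum.elim (fun _ => c) b ∈ W := by
    refine ⟨?_, ?_, mem_iInter.2 hTb⟩
    · change (fun _ => c) ∈ fiber G b
      rw [hGS]
      exact hc
    · simp [hN]
  exact mem_acl_of_finite hW hWf hcW (Sum.inl 0)

theorem acl_subset_acl_of_subset {A B : Set K} (h : A ⊆ acl L B) : acl L A ⊆ acl L B := by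
  rw [← acl_acl B]
  exact acl_mono h

end Closure

/-! ### Bases and the dimension of tuples -/

section Pregeometry

variable (L : FirstOrder.Language.{u, v}) {K : Type w} [L.Structure K]

/-- The elements of `I` are `acl`-independent over `A`. -/
def IndepSet (A I : Set K) : Prop :=
  ∀ x ∈ I, x ∉ acl L (A ∪ (I \ {x}))

/-- `I` is `acl`-independent over `A` and interalgebraic over `A` with `X`. -/
structure IsAclBasis (A X : Set K) (I : Finset K) : Prop where
  indep : IndepSet L A I
  subset : (I : Set K) ⊆ acl L (A ∪ X)
  spans : X ⊆ acl L (A ∪ I)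

variable {L}

theorem IndepSet.mono {A I J : Set K} (h : IndepSet L A J) (hIJ : I ⊆ J) : IndepSet L A I :=
  fun x hx hxI => h x (hIJ hx)
    (acl_mono (union_subset_union_right _ (sdiff_subset_sdiff_left hIJ)) hxI)

theorem indepSet_empty (A : Set K) : IndepSet L A ∅ := fun _ h => h.elim

theorem IndepSet.insert (hE : HasExchange L K) {A I : Set K} (h : IndepSet L A I) {x : K}
    (hx : x ∉ acl L (A ∪ I)) : IndepSet L A (insert x I) := by
  rintro y (rfl | hy) hyc
  · exact hx (acl_mono (union_subset_union_right _ (by simp)) hyc)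
  · have h1 : y ∈ acl L (Insert.insert x (A ∪ (I \ {y}))) := by
      refine acl_mono ?_ hyc
      rintro z (hz | ⟨rfl | hz, hzy⟩)
      · exact Or.inr (Or.inl hz)
      · exact Or.inl rfl
      · exact Or.inr (Or.inr ⟨hz, hzy⟩)
    refine hx (acl_mono ?_ (hE _ _ _ h1 (h y hy)))
    rintro z (rfl | hz | hz)
    · exact Or.inr hy
    · exact Or.inl hz
    · exact Or.inr hz.1

/-- Steinitz exchange. An x in I outside J can be replaced by some y in J not algebraic over the
rest of I: were there none, x itself would be algebraic over the rest. This keeps the size of I and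
shrinks I \ J. -/
theorem IndepSet.card_le (hE : HasExchange L K) {A : Set K} {I J : Finset K}
    (hI : IndepSet L A I) (hIJ : (I : Set K) ⊆ acl L (A ∪ J)) : I.card ≤ J.card := by
  classical
  induction hn : (I \ J).card using Nat.strong_induction_on generalizing I with
  | _ n ih =>
    by_cases hsub : I ⊆ J
    · exact Finset.card_le_card hsub
    obtain ⟨x, hxI, hxJ⟩ := Finset.not_subset.1 hsub
    have hex : ∃ y ∈ J, y ∉ acl L (A ∪ ((I : Set K) \ {x})) := by
      by_contra! h
      refine hI x hxI (acl_subset_acl_of_subset ?_ (hIJ hxI))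
      rintro z (hz | hz)
      · exact subset_acl _ (Or.inl hz)
      · exact h z hz
    obtain ⟨y, hyJ, hy⟩ := hex
    have hyI : y ∉ I.erase x := by
      intro h
      refine hy (subset_acl _ (Or.inr ?_))
      simpa [and_comm] using h
    have hcard : (Insert.insert y (I.erase x)).card = I.card := by
      rw [Finset.card_insert_of_notMem hyI, Finset.card_erase_of_mem hxI]
      have := Finset.card_pos.2 ⟨x, hxI⟩
      omega
    rw [← hcard]
    refine ih _ ?_ (I := Insert.insert y (I.erase x)) ?_ ?_ rfl
    · rw [← hn]
      refine Finset.card_lt_card ⟨?_, ?_⟩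
      · intro z hz
        simp only [Finset.mem_sdiff, Finset.mem_insert, Finset.mem_erase] at hz ⊢
        rcases hz with ⟨rfl | hz, hzJ⟩
        · exact absurd hyJ hzJ
        · exact ⟨hz.2, hzJ⟩
      · intro h
        have := h (Finset.mem_sdiff.2 ⟨hxI, hxJ⟩)
        simp only [Finset.mem_sdiff, Finset.mem_insert, Finset.mem_erase] at this
        rcases this.1 with rfl | h
        · exact hxJ hyJ
        · exact h.1 rfl
    · rw [Finset.coe_insert, Finset.coe_erase]
      exact (hI.mono sdiff_subset).insert hE hy
    · rw [Finset.coe_insert, Finset.coe_erase]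
      refine insert_subset (subset_acl _ (Or.inr hyJ)) (sdiff_subset.trans hIJ)

theorem exists_isAclBasis (hE : HasExchange L K) (A : Set K) {X : Set K} (hX : X.Finite) :
    ∃ I : Finset K, (I : Set K) ⊆ X ∧ IsAclBasis L A X I := by
  classical
  induction X, hX using Set.Finite.induction_on with
  | empty => exact ⟨∅, by simp, by simpa using indepSet_empty A, by simp, by simp⟩
  | @insert x X _ _ ih =>
    obtain ⟨I, hIX, hI⟩ := ih
    by_cases hx : x ∈ acl L (A ∪ I)
    · exact ⟨I, hIX.trans (subset_insert _ _), hI.indep,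
        fun y hy => subset_acl _ (Or.inr (Or.inr (hIX hy))), insert_subset hx hI.spans⟩
    · have hs : ((Insert.insert x I : Finset K) : Set K) ⊆ Insert.insert x X := by
        rw [Finset.coe_insert]
        exact insert_subset_insert hIX
      refine ⟨Insert.insert x I, hs, ?_, fun y hy => subset_acl _ (Or.inr (hs hy)), ?_⟩
      · rw [Finset.coe_insert]
        exact hI.indep.insert hE hx
      · rw [Finset.coe_insert]
        exact insert_subset (subset_acl _ (by simp)) (hI.spans.trans
          (acl_mono (union_subset_union_right _ (subset_insert _ _))))

theorem card_le_card_of_isAclBasis (hE : HasExchange L K) {A X Y : Set K} {I J : Finset K}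
    (hI : IsAclBasis L A X I) (hJ : IsAclBasis L A Y J) (h : X ⊆ acl L (A ∪ Y)) :
    I.card ≤ J.card := by
  refine hI.indep.card_le hE (hI.subset.trans (acl_subset_acl_of_subset ?_))
  refine union_subset (fun y hy => subset_acl _ (Or.inl hy)) (h.trans ?_)
  exact acl_subset_acl_of_subset
    (union_subset (fun y hy => subset_acl _ (Or.inl hy)) hJ.spans)

/-- An independent set of indices carries no repeated entries, so its size is bounded by exchange. A
basis chosen among the entries of the tuple attains the bound, so the supremum is a genuine maximum.
-/
theorem IsAclBasis.tupleDim_eq (hE : HasExchange L K) {ι : Type} [Finite ι] {A : Set K}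
    {a : ι → K} {I : Finset K} (hI : IsAclBasis L A (range a) I) : tupleDim L A a = I.card := by
  classical
  have hle : ∀ s : Finset ι, AclIndep L A a s → s.card ≤ I.card := by
    intro s hs
    have hinj : InjOn a s := by
      intro i hi j hj hij
      by_contra hne
      exact hs i hi (subset_acl _ (Or.inr ⟨j, ⟨hj, Ne.symm hne⟩, hij.symm⟩))
    rw [← Finset.card_image_of_injOn hinj]
    refine IndepSet.card_le (A := A) hE ?_ ?_
    · intro x hx hxc
      obtain ⟨i, hi, rfl⟩ := Finset.mem_image.1 hx
      refine hs i hi (acl_mono (union_subset_union_right _ ?_) hxc)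
      rintro y ⟨hy, hyi⟩
      obtain ⟨j, hj, rfl⟩ := Finset.mem_image.1 hy
      exact ⟨j, ⟨hj, fun h => hyi (by simp [h])⟩, rfl⟩
    · intro x hx
      obtain ⟨i, -, rfl⟩ := Finset.mem_image.1 hx
      exact hI.spans ⟨i, rfl⟩
  have hatt : ∃ s : Finset ι, AclIndep L A a s ∧ s.card = I.card := by
    obtain ⟨J, hJa, hJ⟩ := exists_isAclBasis hE A (finite_range a)
    have hcard : J.card = I.card := le_antisymm
      (card_le_card_of_isAclBasis hE hJ hI fun y hy => subset_acl _ (Or.inr hy))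
      (card_le_card_of_isAclBasis hE hI hJ fun y hy => subset_acl _ (Or.inr hy))
    choose g hg using fun x : J => hJa x.2
    have hginj : Function.Injective g := fun x y h => Subtype.ext (by rw [← hg x, ← hg y, h])
    refine ⟨Finset.univ.image g, ?_, ?_⟩
    · intro i hi hc
      obtain ⟨x, -, rfl⟩ := Finset.mem_image.1 hi
      rw [hg x] at hc
      refine hJ.indep x x.2 (acl_mono (union_subset_union_right _ ?_) hc)
      rintro _ ⟨j, ⟨hj, hne⟩, rfl⟩
      obtain ⟨y, -, rfl⟩ := Finset.mem_image.1 hj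
      rw [hg y]
      exact ⟨y.2, fun h => hne (by rw [Subtype.ext (mem_singleton_iff.1 h)])⟩
    · rw [Finset.card_image_of_injective _ hginj, Finset.card_univ, Fintype.card_coe, hcard]
  refine le_antisymm (csSup_le ⟨_, hatt⟩ ?_) (le_csSup ⟨I.card, ?_⟩ hatt)
  · rintro _ ⟨s, hs, rfl⟩
    exact hle s hs
  · rintro _ ⟨s, hs, rfl⟩
    exact hle s hs

variable {ι κ : Type} [Finite ι] [Finite κ]

theorem tupleDim_le_of_range_subset (hE : HasExchange L K) {A : Set K} {a : ι → K} {b : κ → K}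
    (h : range a ⊆ acl L (A ∪ range b)) : tupleDim L A a ≤ tupleDim L A b := by
  obtain ⟨I, -, hI⟩ := exists_isAclBasis hE A (finite_range a)
  obtain ⟨J, -, hJ⟩ := exists_isAclBasis hE A (finite_range b)
  rw [hI.tupleDim_eq hE, hJ.tupleDim_eq hE]
  exact card_le_card_of_isAclBasis hE hI hJ h

theorem tupleDim_congr (hE : HasExchange L K) {A : Set K} {a : ι → K} {b : κ → K}
    (h : range a = range b) : tupleDim L A a = tupleDim L A b :=
  le_antisymm (tupleDim_le_of_range_subset hE fun _ hx => subset_acl _ (Or.inr (h ▸ hx)))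
    (tupleDim_le_of_range_subset hE fun _ hx => subset_acl _ (Or.inr (h ▸ hx)))

theorem tupleDim_comp_le (hE : HasExchange L K) (A : Set K) (a : ι → K) (e : κ → ι) :
    tupleDim L A (a ∘ e) ≤ tupleDim L A a :=
  tupleDim_le_of_range_subset hE fun _ hx => subset_acl _ (Or.inr (range_comp_subset_range _ _ hx))

theorem tupleDim_comp_equiv (hE : HasExchange L K) (A : Set K) (a : ι → K) (e : κ ≃ ι) :
    tupleDim L A (a ∘ e) = tupleDim L A a :=
  tupleDim_congr hE (e.surjective.range_comp a)

theorem tupleDim_mono (hE : HasExchange L K) {A B : Set K} (h : A ⊆ acl L B) (a : ι → K) :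
    tupleDim L B a ≤ tupleDim L A a := by
  obtain ⟨I, -, hI⟩ := exists_isAclBasis hE A (finite_range a)
  obtain ⟨J, hJa, hJ⟩ := exists_isAclBasis hE B (finite_range a)
  rw [hI.tupleDim_eq hE, hJ.tupleDim_eq hE]
  refine hJ.indep.card_le hE (hJa.trans (hI.spans.trans (acl_subset_acl_of_subset ?_)))
  refine union_subset (h.trans (acl_mono subset_union_left)) fun y hy => subset_acl _ (Or.inr hy)

/-- A basis of b over A together with a basis of a over Ab is a basis of the joint tuple over A. -/
theorem tupleDim_sumElim (hE : HasExchange L K) (A : Set K) (a : ι → K) (b : κ → K) :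
    tupleDim L A (Sum.elim a b) = tupleDim L A b + tupleDim L (A ∪ range b) a := by
  classical
  obtain ⟨I, hIb, hI⟩ := exists_isAclBasis hE A (finite_range b)
  obtain ⟨J, hJa, hJ⟩ := exists_isAclBasis hE (A ∪ range b) (finite_range a)
  have hAI : A ∪ range b ⊆ acl L (A ∪ I) :=
    union_subset (fun y hy => subset_acl _ (Or.inl hy)) hI.spans
  have hdisj : Disjoint I J := by
    rw [Finset.disjoint_left]
    intro x hxI hxJ
    exact hJ.indep x hxJ (subset_acl _ (Or.inl (Or.inr (hIb hxI))))
  have key : ∀ J' ⊆ J, IndepSet L A (I ∪ J' : Finset K) := by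
    intro J'
    induction J' using Finset.induction_on with
    | empty => intro _; simpa using hI.indep
    | insert x J' hx ih =>
      intro hs
      have hind := ih ((Finset.subset_insert _ _).trans hs)
      rw [Finset.union_insert, Finset.coe_insert]
      refine hind.insert hE fun hxc => ?_
      refine hJ.indep x (hs (Finset.mem_insert_self _ _)) (acl_mono ?_ hxc)
      rintro z (hz | hz)
      · exact Or.inl (Or.inl hz)
      · rcases Finset.mem_union.1 hz with hz | hz
        · exact Or.inl (Or.inr (hIb hz))
        · exact Or.inr ⟨hs (Finset.mem_insert_of_mem hz), fun h => hx (h ▸ hz)⟩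
  have hU : IsAclBasis L A (range (Sum.elim a b)) (I ∪ J) := by
    refine ⟨key J subset_rfl, ?_, ?_⟩
    · rw [Sum.elim_range, Finset.coe_union]
      exact union_subset (fun x hx => subset_acl _ (Or.inr (Or.inr (hIb hx))))
        (fun x hx => subset_acl _ (Or.inr (Or.inl (hJa hx))))
    · rw [Sum.elim_range, Finset.coe_union]
      refine union_subset (hJ.spans.trans (acl_subset_acl_of_subset (union_subset
        (hAI.trans (acl_mono (union_subset_union_right _ subset_union_left))) fun y hy =>
          subset_acl _ (Or.inr (Or.inr hy)))))
        (hI.spans.trans (acl_mono (union_subset_union_right _ subset_union_left)))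
  rw [hU.tupleDim_eq hE, hI.tupleDim_eq hE, hJ.tupleDim_eq hE, Finset.card_union_of_disjoint hdisj]

theorem tupleDim_sumElim' (hE : HasExchange L K) (A : Set K) (a : ι → K) (b : κ → K) :
    tupleDim L A (Sum.elim a b) = tupleDim L A a + tupleDim L (A ∪ range a) b := by
  rw [← tupleDim_sumElim hE]
  refine tupleDim_congr hE ?_
  rw [Sum.elim_range, Sum.elim_range, union_comm]

theorem tupleDim_eq_zero_iff (hE : HasExchange L K) {A : Set K} {a : ι → K} :
    tupleDim L A a = 0 ↔ range a ⊆ acl L A := by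
  obtain ⟨I, hIa, hI⟩ := exists_isAclBasis hE A (finite_range a)
  rw [hI.tupleDim_eq hE, Finset.card_eq_zero]
  constructor
  · rintro rfl
    simpa using hI.spans
  · intro h
    rw [Finset.eq_empty_iff_forall_notMem]
    intro x hx
    exact hI.indep x hx (acl_mono subset_union_left (h (hIa hx)))

theorem exists_comp_tupleDim (hE : HasExchange L K) (A : Set K) (a : ι → K) :
    ∃ e : Fin (tupleDim L A a) → ι, range a ⊆ acl L (A ∪ range (a ∘ e)) := by
  obtain ⟨I, hIa, hI⟩ := exists_isAclBasis hE A (finite_range a)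
  rw [hI.tupleDim_eq hE]
  choose g hg using fun x : I => hIa x.2
  refine ⟨fun i => g (I.equivFin.symm i), hI.spans.trans (acl_mono (union_subset_union_right _ ?_))⟩
  intro x hx
  exact ⟨I.equivFin ⟨x, hx⟩, by simp [hg]⟩

theorem tupleDim_le_natCard (hE : HasExchange L K) (A : Set K) (a : ι → K) :
    tupleDim L A a ≤ Nat.card ι := by
  classical
  have := Fintype.ofFinite ι
  obtain ⟨I, hIa, hI⟩ := exists_isAclBasis hE A (finite_range a)
  rw [hI.tupleDim_eq hE, Nat.card_eq_fintype_card]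
  have : I ⊆ Finset.univ.image a := fun x hx => by
    obtain ⟨i, rfl⟩ := hIa hx
    simp
  exact (Finset.card_le_card this).trans Finset.card_image_le

end Pregeometry

/-! ### Saturated geometric structures -/

section Geometric

theorem IsAleph1Saturated.exists_mem_of_antitone {L : FirstOrder.Language.{u, v}} {K : Type w}
    [L.Structure K] (hs : IsAleph1Saturated L K) {ι : Type} [Finite ι] {A : Set K}
    (hA : A.Countable) {R : ℕ → Set (ι → K)} (hR : Antitone R) (hd : ∀ k, A.Definable L (R k))
    (hne : ∀ k, (R k).Nonempty) : ∃ x, ∀ k, x ∈ R k := by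
  classical
  obtain ⟨x, hx⟩ := hs ι A hA (range R) (by rintro _ ⟨k, rfl⟩; exact hd k) (by
    intro G hG
    have : ∃ k, R k ⊆ ⋂₀ (G : Set (Set (ι → K))) := by
      induction G using Finset.induction_on with
      | empty => exact ⟨0, by simp⟩
      | insert S G _ ih =>
        rw [Finset.coe_insert] at hG ⊢
        obtain ⟨k, hk⟩ := ih ((subset_insert _ _).trans hG)
        obtain ⟨l, rfl⟩ := hG (mem_insert _ _)
        refine ⟨max k l, ?_⟩
        rw [sInter_insert]
        exact subset_inter (hR (le_max_right _ _)) ((hR (le_max_left _ _)).trans hk)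
    obtain ⟨k, hk⟩ := this
    exact (hne k).mono hk)
  exact ⟨x, fun k => hx _ ⟨k, rfl⟩⟩

variable (L : FirstOrder.Language.{u, v}) (K : Type w) [L.Structure K]

/-- An `ℵ₁`-saturated structure with exchange in which the finite fibres of a definable family of
subsets of the line are bounded in size. -/
structure IsSaturatedGeometric : Prop where
  exchange : HasExchange L K
  finite_bound : ∀ (κ : Type) [Finite κ] (G : Set (Fin 1 ⊕ κ → K)), (∅ : Set K).Definable L G →
    ∃ N : ℕ, ∀ t, (fiber G t).Finite → (fiber G t).encard ≤ N
  saturated : IsAleph1Saturated L K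

variable {L K}

/-- Finiteness of the fibre is a definable condition on the parameter. If finite fibres were
unbounded in size, saturation would realize a parameter whose fibre is finite and yet has at least k
elements for every k. -/
theorem IsHausdorffGeometric.isSaturatedGeometric [TopologicalSpace K]
    (hK : IsHausdorffGeometric L K) : IsSaturatedGeometric L K := by
  obtain ⟨hex, helim⟩ := hK.geometric K (rfl)
  refine ⟨hex, fun κ _ G hG => ?_, hK.saturated⟩
  let e := Finite.equivFin κ
  let n := Nat.card κ
  have hG' := hG.preimage_comp (Sum.elim (fun _ => 0) (fun k => (e k).succ) :
    Fin 1 ⊕ κ → Fin (n + 1))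
  obtain ⟨φ, hφ⟩ := empty_definable_iff.1 hG'
  have hfin : ∀ b : Fin n → K,
      {a : K | φ.Realize (Fin.cons a b : Fin (n + 1) → K)}.Finite ↔ (fiber G (b ∘ e)).Finite := by
    intro b
    have : fiber G (b ∘ e) = (Equiv.funUnique (Fin 1) K) ⁻¹'
        {a : K | φ.Realize (Fin.cons a b : Fin (n + 1) → K)} := by
      ext x
      have := Set.ext_iff.1 hφ (Fin.cons (x 0) b : Fin (n + 1) → K)
      rw [mem_preimage, mem_ofPred_eq] at this
      simp only [fiber, mem_preimage, mem_ofPred_eq, Equiv.funUnique_apply]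
      rw [show (default : Fin 1) = 0 from rfl, ← this]
      refine iff_of_eq (congrArg (· ∈ G) ?_)
      funext z
      rcases z with z | z
      · rw [Subsingleton.elim z 0]
        rfl
      · simp
    rw [this]
    refine ⟨fun h => h.preimage (Equiv.injective _).injOn, fun h => ?_⟩
    exact h.of_preimage (Equiv.surjective _)
  obtain ⟨A, -, hA⟩ := definable_iff_finitely_definable.1 (helim n φ)
  by_contra! hunb
  obtain ⟨b, hb⟩ := hK.saturated.exists_mem_of_antitone A.countable_toSet (ι := Fin n)
    (R := fun k => {b : Fin n → K | {a : K | φ.Realize (Fin.cons a b : Fin (n + 1) → K)}.Finite} ∩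
      (fun b => b ∘ e) ⁻¹' {t | (k : ℕ∞) ≤ (fiber G t).encard})
    (fun k l hkl => inter_subset_inter_right _ (preimage_mono fun t ht =>
      le_trans (Nat.cast_le.2 hkl : (k : ℕ∞) ≤ l) ht))
    (fun k => hA.inter (((definable_le_encard_fiber hG k).mono (empty_subset _)).preimage_comp _))
    (fun k => by
      obtain ⟨t, ht, hk⟩ := hunb k
      have : (t ∘ e.symm) ∘ e = t := by rw [Function.comp_assoc, e.symm_comp_self]; rfl
      refine ⟨t ∘ e.symm, ?_, ?_⟩
      · rw [mem_ofPred_eq, hfin, this]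
        exact ht
      · rw [mem_preimage, this]
        exact hk.le)
  have h1 := (hfin b).1 (hb 0).1
  obtain ⟨N, hN⟩ : ∃ N : ℕ, (fiber G (b ∘ e)).encard = N := ⟨_, h1.cast_ncard_eq.symm⟩
  have h2 := (hb (N + 1)).2
  rw [mem_preimage, mem_ofPred_eq, hN] at h2
  exact absurd (Nat.cast_le.1 h2) (by omega)

namespace IsSaturatedGeometric

section

variable {ι κ : Type} [Finite ι] [Finite κ] {A : Set K}

/-- With a uniform bound N on finite fibres, infinite means having at least N + 1 elements. The
bound is available for families without parameters, so these are first made part of the index. -/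
theorem definable_infinite_fiber_line (hK : IsSaturatedGeometric L K) {G : Set (Fin 1 ⊕ κ → K)}
    (hG : A.Definable L G) :
    A.Definable L {t | (fiber G t).Infinite} := by
  obtain ⟨n, b, G', hb, hG', rfl⟩ := exists_tuple_of_definable hG
  let f : (Fin 1 ⊕ κ) ⊕ Fin n → Fin 1 ⊕ (κ ⊕ Fin n) := (Equiv.sumAssoc _ _ _)
  obtain ⟨N, hN⟩ := hK.finite_bound _ _ (hG'.preimage_comp f)
  have hfib : ∀ t, fiber (fiber G' b) t = fiber ((fun g => g ∘ f) ⁻¹' G') (Sum.elim t b) := by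
    intro t
    ext x
    simp only [fiber, mem_ofPred_eq, mem_preimage]
    refine iff_of_eq (congrArg (· ∈ G') ?_)
    funext z
    rcases z with (z | z) | z <;> rfl
  convert definable_le_encard_fiber hG (N + 1) using 1
  ext t
  rw [mem_ofPred_eq, mem_ofPred_eq]
  constructor
  · intro h
    rw [h.encard_eq]
    exact le_top
  · intro h hf
    rw [hfib] at h hf
    have := h.trans (hN _ hf)
    exact absurd (Nat.cast_le.1 this) (by omega)

theorem _root_.Set.infinite_iff_exists_infinite_image_eval {S : Set (ι → K)} :
    S.Infinite ↔ ∃ i, ((fun x (_ : Fin 1) => x i) '' S).Infinite := by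
  constructor
  · intro h
    by_contra! hf
    refine h ((Finite.pi' fun i => (hf i).image fun y => y 0).subset fun x hx i => ?_)
    exact ⟨fun _ => x i, ⟨x, hx, rfl⟩, rfl⟩
  · rintro ⟨i, hi⟩
    exact hi.of_image _

theorem fiber_image_comp_sumMap {ι κ : Type} (G : Set (ι ⊕ κ → K)) (i : ι) (t : κ → K) :
    fiber ((fun g => g ∘ (Sum.map (fun _ : Fin 1 => i) id : Fin 1 ⊕ κ → ι ⊕ κ)) '' G) t =
      (fun x (_ : Fin 1) => x i) '' fiber G t := by
  ext y
  simp only [fiber, mem_ofPred_eq, mem_image]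
  constructor
  · rintro ⟨g, hg, h⟩
    have h2 : Sum.elim (g ∘ Sum.inl) t = g := by
      funext z
      rcases z with z | z
      · rfl
      · exact (congrFun h (Sum.inr z)).symm
    refine ⟨g ∘ Sum.inl, by rwa [h2], ?_⟩
    funext j
    exact congrFun h (Sum.inl j)
  · rintro ⟨x, hx, rfl⟩
    refine ⟨_, hx, ?_⟩
    funext z
    rcases z with z | z <;> rfl

theorem definable_infinite_fiber (hK : IsSaturatedGeometric L K) {G : Set (ι ⊕ κ → K)}
    (hG : A.Definable L G) :
    A.Definable L {t | (fiber G t).Infinite} := by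
  convert definable_iUnion_of_finite fun i => hK.definable_infinite_fiber_line
    (hG.image_comp (Sum.map (fun _ : Fin 1 => i) id)) using 1
  ext t
  simp only [mem_ofPred_eq, mem_iUnion, fiber_image_comp_sumMap]
  exact Set.infinite_iff_exists_infinite_image_eval

theorem tupleDim_fin_one_eq_one (hE : HasExchange L K) {x : Fin 1 → K} (hx : x 0 ∉ acl L A) :
    tupleDim L A x = 1 := by
  have h1 := tupleDim_le_natCard hE A x
  have h2 : tupleDim L A x ≠ 0 := fun h => hx ((tupleDim_eq_zero_iff hE).1 h ⟨0, rfl⟩)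
  rw [Nat.card_fin] at h1
  omega

/-- The `A`-definable sets containing all but finitely many points of S have the finite intersection
property; a common point avoids every finite `A`-definable set. -/
theorem exists_tupleDim_eq_one (hK : IsSaturatedGeometric L K) (hA : A.Countable)
    {S : Set (Fin 1 → K)} (hS : A.Definable L S)
    (hinf : S.Infinite) : ∃ x ∈ S, tupleDim L A x = 1 := by
  classical
  obtain ⟨x, hx⟩ := hK.saturated (Fin 1) A hA {R | A.Definable L R ∧ (S \ R).Finite}
    (fun R hR => hR.1) (by
      intro G hG
      have : (S \ ⋂₀ (G : Set (Set (Fin 1 → K)))).Finite := by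
        refine (G.finite_toSet.biUnion fun R hR => (hG hR).2).subset fun x hx => ?_
        by_contra hn
        simp only [mem_iUnion, not_exists] at hn
        exact hx.2 fun R hR => by_contra fun hxR => hn R hR ⟨hx.1, hxR⟩
      obtain ⟨x, hx⟩ := (hinf.sdiff this).nonempty
      exact ⟨x, by_contra fun h => hx.2 ⟨hx.1, h⟩⟩)
  refine ⟨x, hx S ⟨hS, by simp⟩, tupleDim_fin_one_eq_one hK.exchange ?_⟩
  rintro ⟨T, hT, hf, hxT⟩
  refine hx {y | y 0 ∈ T}ᶜ ⟨Definable.compl hT, ?_⟩ hxT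
  refine (hf.preimage (Equiv.funUnique (Fin 1) K).injective.injOn).subset fun y hy => ?_
  simpa using hy.2

end

/-- The first coordinate, and the remaining ones. -/
def finSuccSplit (n : ℕ) : Fin 1 ⊕ Fin n ≃ Fin (n + 1) :=
  finSumFinEquiv.trans (finCongr (add_comm 1 n))

/-! ### Independent tuples, by induction on their length -/

section

variable {A : Set K} {n : ℕ}

theorem tupleDim_split (hE : HasExchange L K) (y : Fin (n + 1) → K) :
    tupleDim L A y = tupleDim L A (y ∘ finSuccSplit n ∘ Sum.inr) +
      tupleDim L (A ∪ range (y ∘ finSuccSplit n ∘ Sum.inr)) (y ∘ finSuccSplit n ∘ Sum.inl) := by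
  rw [← tupleDim_sumElim hE, ← tupleDim_comp_equiv hE A y (finSuccSplit n)]
  congr 1
  funext z
  rcases z with z | z <;> rfl

theorem tupleDim_split_eq (hE : HasExchange L K) {y : Fin (n + 1) → K}
    (hy : tupleDim L A y = n + 1) :
    tupleDim L A (y ∘ finSuccSplit n ∘ Sum.inr) = n ∧
      tupleDim L (A ∪ range (y ∘ finSuccSplit n ∘ Sum.inr)) (y ∘ finSuccSplit n ∘ Sum.inl) = 1 := by
  rw [tupleDim_split hE] at hy
  have h1 := tupleDim_le_natCard hE A (y ∘ finSuccSplit n ∘ Sum.inr)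
  have h2 := tupleDim_le_natCard hE (A ∪ range (y ∘ finSuccSplit n ∘ Sum.inr))
    (y ∘ finSuccSplit n ∘ Sum.inl)
  rw [Nat.card_fin] at h1 h2
  omega

theorem infinite_of_tupleDim_eq_one (hE : HasExchange L K) {x : Fin 1 → K} (hx : tupleDim L A x = 1)
    {S : Set (Fin 1 → K)} (hS : A.Definable L S) (hxS : x ∈ S) : S.Infinite := by
  intro hf
  have : tupleDim L A x = 0 := (tupleDim_eq_zero_iff hE).2 (by
    rintro _ ⟨i, rfl⟩
    exact mem_acl_of_finite hS hf hxS i)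
  omega

/-- A preimage under `finSuccSplit`, so that its fibres are subsets of the line. -/
def splitSet (Y : Set (Fin (n + 1) → K)) : Set (Fin 1 ⊕ Fin n → K) :=
  (fun g => g ∘ (finSuccSplit n).symm) ⁻¹' Y

theorem mem_fiber_splitSet (Y : Set (Fin (n + 1) → K)) (y : Fin (n + 1) → K) :
    y ∘ finSuccSplit n ∘ Sum.inl ∈ fiber (splitSet Y) (y ∘ finSuccSplit n ∘ Sum.inr) ↔ y ∈ Y := by
  refine iff_of_eq (congrArg (· ∈ Y) ?_)
  funext z
  obtain ⟨z, rfl⟩ := (finSuccSplit n).surjective z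
  rcases z with z | z <;> simp

/-- The set of tails with infinite fibre is definable and contains the tail of y, hence by induction
a tail independent over B. The infinite fibre above it contains a point that is not algebraic over B
and that tail. -/
theorem exists_tupleDim_eq (hK : IsSaturatedGeometric L K) {B : Set K} (hB : B.Countable)
    (hAB : A ⊆ B)
    {Y : Set (Fin n → K)} (hY : A.Definable L Y) {y : Fin n → K} (hy : y ∈ Y)
    (hyn : tupleDim L A y = n) : ∃ z ∈ Y, tupleDim L B z = n := by
  induction n with
  | zero =>
    refine ⟨y, hy, ?_⟩
    have := tupleDim_le_natCard hK.exchange B y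
    rw [Nat.card_fin] at this
    omega
  | succ n ih =>
    obtain ⟨h1, h2⟩ := tupleDim_split_eq hK.exchange hyn
    have hG : A.Definable L (splitSet Y) := hY.preimage_comp _
    obtain ⟨z', hz', hzn⟩ := ih (hK.definable_infinite_fiber hG)
      (infinite_of_tupleDim_eq_one hK.exchange h2 (definable_fiber hG _)
        ((mem_fiber_splitSet Y y).2 hy)) h1
    obtain ⟨z0, hz0, hz01⟩ := hK.exists_tupleDim_eq_one (A := B ∪ range z')
      (hB.union (countable_range z'))
      ((definable_fiber hG z').mono (union_subset_union_left _ hAB)) hz'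
    have hl : (Sum.elim z0 z' ∘ (finSuccSplit n).symm) ∘ finSuccSplit n ∘ Sum.inl = z0 := by
      funext; simp
    have hr : (Sum.elim z0 z' ∘ (finSuccSplit n).symm) ∘ finSuccSplit n ∘ Sum.inr = z' := by
      funext; simp
    refine ⟨Sum.elim z0 z' ∘ (finSuccSplit n).symm, hz0, ?_⟩
    rw [tupleDim_split hK.exchange, hl, hr, hzn, hz01]

end

/-! ### Dimension of definable sets and its independence of the parameters -/

section

variable {ι κ : Type} [Finite ι] [Finite κ] {A B : Set K} {X Y : Set (ι → K)}

/-- Projecting to coordinates that form a basis of a reduces to the case of an independent tuple. -/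
theorem exists_tupleDim_le (hK : IsSaturatedGeometric L K) (hB : B.Countable) (hAB : A ⊆ B)
    (hX : A.Definable L X) {a : ι → K}
    (ha : a ∈ X) : ∃ b ∈ X, tupleDim L A a ≤ tupleDim L B b := by
  obtain ⟨e, he⟩ := exists_comp_tupleDim hK.exchange A a
  have hdim : tupleDim L A (a ∘ e) = tupleDim L A a :=
    le_antisymm (tupleDim_comp_le hK.exchange A a e) (tupleDim_le_of_range_subset hK.exchange he)
  obtain ⟨_, ⟨b, hb, rfl⟩, hbd⟩ := hK.exists_tupleDim_eq hB hAB (hX.image_comp e) ⟨a, ha, rfl⟩ hdim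
  exact ⟨b, hb, hbd.ge.trans (tupleDim_comp_le hK.exchange B b e)⟩

theorem tupleDim_le_dimOver (hK : IsSaturatedGeometric L K) {x : ι → K}
    (hx : x ∈ X) : tupleDim L A x ≤ dimOver L A X :=
  le_csSup ⟨Nat.card ι, by rintro _ ⟨y, -, rfl⟩; exact tupleDim_le_natCard hK.exchange A y⟩
    ⟨x, hx, rfl⟩

theorem dimOver_le {ι : Type} {X : Set (ι → K)} {n : ℕ}
    (h : ∀ x ∈ X, tupleDim L A x ≤ n) : dimOver L A X ≤ n := by
  rcases X.eq_empty_or_nonempty with rfl | ⟨x, hx⟩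
  · simp [dimOver]
  · refine csSup_le ⟨_, x, hx, rfl⟩ ?_
    rintro _ ⟨y, hy, rfl⟩
    exact h y hy

theorem dimOver_eq_of_subset (hK : IsSaturatedGeometric L K) (hB : B.Countable) (hAB : A ⊆ B)
    (hX : A.Definable L X) :
    dimOver L A X = dimOver L B X := by
  refine le_antisymm (dimOver_le fun a ha => ?_) (dimOver_le fun a ha => ?_)
  · obtain ⟨b, hb, h⟩ := hK.exists_tupleDim_le hB hAB hX ha
    exact h.trans (hK.tupleDim_le_dimOver hb)
  · exact (tupleDim_mono hK.exchange (hAB.trans (subset_acl _)) a).trans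
      (hK.tupleDim_le_dimOver ha)

/-- Two countable sets of definition give the same value, since both agree with their union. The
infimum defining `setDim` is therefore over a singleton. -/
theorem setDim_eq_dimOver (hK : IsSaturatedGeometric L K) (hA : A.Countable)
    (hX : A.Definable L X) :
    setDim L X = dimOver L A X := by
  have : {n | ∃ A : Set K, A.Countable ∧ A.Definable L X ∧ dimOver L A X = n} =
      {dimOver L A X} := by
    ext n
    constructor
    · rintro ⟨A', hA', hX', rfl⟩
      rw [mem_singleton_iff, hK.dimOver_eq_of_subset (hA'.union hA) subset_union_left hX',
        hK.dimOver_eq_of_subset (hA'.union hA) subset_union_right hX]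
    · rintro rfl
      exact ⟨A, hA, hX, rfl⟩
  rw [setDim, this, csInf_singleton]

theorem tupleDim_le_setDim (hK : IsSaturatedGeometric L K) (hA : A.Countable)
    (hX : A.Definable L X) {x : ι → K} (hx : x ∈ X) :
    tupleDim L A x ≤ setDim L X := by
  rw [hK.setDim_eq_dimOver hA hX]
  exact hK.tupleDim_le_dimOver hx

theorem setDim_le (hK : IsSaturatedGeometric L K) (hA : A.Countable) (hX : A.Definable L X) {n : ℕ}
    (h : ∀ x ∈ X, tupleDim L A x ≤ n) : setDim L X ≤ n := by
  rw [hK.setDim_eq_dimOver hA hX]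
  exact dimOver_le h

theorem exists_isGeneric (hK : IsSaturatedGeometric L K) (hA : A.Countable)
    (hX : A.Definable L X) (hne : X.Nonempty) :
    ∃ x, IsGeneric L A X x := by
  obtain ⟨x, hx⟩ := hne
  have := Nat.sSup_mem (s := {n | ∃ x ∈ X, tupleDim L A x = n}) ⟨_, x, hx, rfl⟩
    ⟨Nat.card ι, by rintro _ ⟨y, -, rfl⟩; exact tupleDim_le_natCard hK.exchange A y⟩
  obtain ⟨y, hy, h⟩ := this
  exact ⟨y, hy, h.trans (hK.setDim_eq_dimOver hA hX).symm⟩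

/-- The value comes from the convention that the supremum of the empty set is 0; thus positive
dimension implies nonempty. -/
theorem setDim_empty {ι : Type} : setDim L (∅ : Set (ι → K)) = 0 :=
  Nat.sInf_eq_zero.2 (Or.inl ⟨∅, countable_empty, definable_empty, by simp [dimOver]⟩)

theorem setDim_mono (hK : IsSaturatedGeometric L K) (hA : A.Countable) (hX : A.Definable L X)
    (hY : A.Definable L Y)
    (hXY : X ⊆ Y) : setDim L X ≤ setDim L Y :=
  hK.setDim_le hA hX fun _ hx => hK.tupleDim_le_setDim hA hY (hXY hx)

theorem one_le_setDim (hK : IsSaturatedGeometric L K) (hA : A.Countable) (hX : A.Definable L X)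
    (hinf : X.Infinite) :
    1 ≤ setDim L X := by
  obtain ⟨i, hi⟩ := Set.infinite_iff_exists_infinite_image_eval.1 hinf
  obtain ⟨_, ⟨x, hx, rfl⟩, hd⟩ :=
    hK.exists_tupleDim_eq_one hA (hX.image_comp (fun _ : Fin 1 => i)) hi
  exact (hd.ge.trans (tupleDim_comp_le hK.exchange A x fun _ : Fin 1 => i)).trans
    (hK.tupleDim_le_setDim hA hX hx)

theorem setDim_eq_zero_of_finite (hK : IsSaturatedGeometric L K) (hA : A.Countable)
    (hX : A.Definable L X) (hfin : X.Finite) :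
    setDim L X = 0 := by
  refine Nat.le_zero.1 (hK.setDim_le hA hX fun x hx => le_of_eq ?_)
  rw [tupleDim_eq_zero_iff hK.exchange]
  rintro _ ⟨i, rfl⟩
  exact mem_acl_of_finite hX hfin hx i

end

end IsSaturatedGeometric

end Geometric

/-! ### Minimal structures -/

section Minimal

variable (L : FirstOrder.Language.{u, v}) (K : Type w) [L.Structure K]

/-- `K` is infinite, and the subsets of `K` that are definable with parameters are finite or
cofinite. -/
structure IsMinimal : Prop where
  infinite : Infinite K
  finite_or_compl_finite : ∀ (A : Set K) (S : Set (Fin 1 → K)), A.Definable L S →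
    S.Finite ∨ Sᶜ.Finite

variable {L K}

/-- Only the trivial elementary extension is used; saturation later supplies the uniformity. -/
theorem IsStronglyMinimal.isMinimal (h : IsStronglyMinimal L K) : IsMinimal L K := by
  refine ⟨h.1, fun A S hS => ?_⟩
  let e := (Equiv.funUnique (Fin 1) K)
  have hpre : S = e ⁻¹' (e '' S) := (preimage_image_eq _ e.injective).symm
  have hd : (univ : Set K).Definable₁ L (e '' S) := by
    rw [Definable₁]
    convert hS.mono (subset_univ A) using 1
    exact hpre.symm
  rcases h.2 K ⟨ElementaryEmbedding.refl L K⟩ (e '' S) hd with hf | hf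
  · left
    rw [hpre]
    exact hf.preimage e.injective.injOn
  · right
    rw [hpre, ← preimage_compl]
    exact hf.preimage e.injective.injOn

namespace IsMinimal

variable {A : Set K}

theorem infinite_compl (hM : IsMinimal L K) {S : Set (Fin 1 → K)} (hS : S.Finite) :
    Sᶜ.Infinite := by
  have := hM.infinite
  exact hS.infinite_compl

/-- Let c be one of the N points of the fibre of G at b. If b is not algebraic over Ac, the set of z
with c in G_z and |G_z| ≤ N is cofinite, missing m points. As c is not algebraic over A, infinitely
many y satisfy the same with y for c and at most m points missed. For N + 1 of them a common z
exists, and G_z has more than N points. -/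
theorem hasExchange (hM : IsMinimal L K) : HasExchange L K := by
  intro A b c hc hcA
  by_contra hb
  have hins : ∀ b : K, insert b A = A ∪ range (fun _ : Fin 1 => b) := by
    intro b
    rw [range_const, union_singleton]
  rw [hins, mem_acl_union_range_iff] at hc
  obtain ⟨G, hG, hf, hcG⟩ := hc
  obtain ⟨N, hN⟩ : ∃ N : ℕ, (fiber G fun _ => b).encard = N := ⟨_, hf.cast_ncard_eq.symm⟩
  let H : Set (Fin 1 ⊕ Fin 1 → K) := (fun w => w ∘ Sum.swap) ⁻¹'
    (G ∩ (fun w => w ∘ Sum.inr) ⁻¹' {t | (fiber G t).encard ≤ N})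
  have hH : A.Definable L H :=
    (hG.inter ((definable_encard_fiber_le hG N).preimage_comp _)).preimage_comp _
  have hHmem : ∀ y z : Fin 1 → K, z ∈ fiber H y ↔ y ∈ fiber G z ∧ (fiber G z).encard ≤ N := by
    intro y z
    have : Sum.elim z y ∘ Sum.swap = Sum.elim y z := by
      funext i
      rcases i with i | i <;> rfl
    simp only [H, fiber, mem_ofPred_eq, mem_preimage, mem_inter_iff, this]
    rfl
  have hbH : (fun _ => b) ∈ fiber H fun _ => c := (hHmem _ _).2 ⟨hcG, hN.le⟩
  have hcof : (fiber Hᶜ fun _ => c).Finite := by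
    rcases hM.finite_or_compl_finite _ _ (definable_fiber hH fun _ => c) with h | h
    · refine absurd ?_ hb
      rw [hins]
      exact mem_acl_of_finite (definable_fiber hH fun _ => c) h hbH 0
    · exact h
  obtain ⟨m, hm⟩ : ∃ m : ℕ, (fiber Hᶜ fun _ => c).encard = m := ⟨_, hcof.cast_ncard_eq.symm⟩
  have hQ := definable_encard_fiber_le hH.compl m
  have hQinf : {y : Fin 1 → K | (fiber Hᶜ y).encard ≤ m}.Infinite := by
    intro h
    exact hcA (mem_acl_of_finite hQ h (x := fun _ => c) hm.le 0)
  obtain ⟨f, hfinj, hfQ⟩ := natCast_le_encard_iff.1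
    (show ((N + 1 : ℕ) : ℕ∞) ≤ _ by rw [hQinf.encard_eq]; exact le_top)
  have hUf : (⋃ i, fiber Hᶜ (f i)).Finite :=
    finite_iUnion fun i => finite_of_encard_le_coe (hfQ i)
  obtain ⟨z, hz⟩ := (hM.infinite_compl hUf).nonempty
  have hz' : ∀ i, f i ∈ fiber G z ∧ (fiber G z).encard ≤ N := by
    intro i
    rw [← hHmem]
    by_contra h
    exact hz (mem_iUnion.2 ⟨i, h⟩)
  have h1 : ((N + 1 : ℕ) : ℕ∞) ≤ (fiber G z).encard :=
    natCast_le_encard_iff.2 ⟨f, hfinj, fun i => (hz' i).1⟩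
  exact absurd (Nat.cast_le.1 (h1.trans (hz' 0).2)) (by omega)

/-- If finite fibres were unbounded in size, then, their complements being infinite, saturation
would give a fibre that is infinite and has infinite complement. -/
theorem isSaturatedGeometric (hM : IsMinimal L K) (hs : IsAleph1Saturated L K) :
    IsSaturatedGeometric L K := by
  refine ⟨hM.hasExchange, fun κ _ G hG => ?_, hs⟩
  by_contra! hunb
  obtain ⟨t, ht⟩ := hs.exists_mem_of_antitone countable_empty
    (R := fun k => {t | (k : ℕ∞) ≤ (fiber G t).encard} ∩ {t | (k : ℕ∞) ≤ (fiber Gᶜ t).encard})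
    (fun k l hkl t ht => ⟨le_trans (Nat.cast_le.2 hkl : (k : ℕ∞) ≤ l) ht.1,
      le_trans (Nat.cast_le.2 hkl : (k : ℕ∞) ≤ l) ht.2⟩)
    (fun k => (definable_le_encard_fiber hG k).inter (definable_le_encard_fiber hG.compl k))
    (fun k => by
      obtain ⟨t, htf, htk⟩ := hunb k
      refine ⟨t, htk.le, ?_⟩
      have : (fiber Gᶜ t).encard = ⊤ := (hM.infinite_compl htf).encard_eq
      rw [mem_ofPred_eq, this]
      exact le_top)
  have hinf : ∀ S : Set (Fin 1 → K), (∀ k : ℕ, (k : ℕ∞) ≤ S.encard) → S.Infinite := by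
    intro S hS hf
    have := hS (S.ncard + 1)
    rw [← hf.cast_ncard_eq] at this
    exact absurd (Nat.cast_le.1 this) (by omega)
  rcases hM.finite_or_compl_finite _ _ (definable_fiber hG t) with h | h
  · exact hinf _ (fun k => (ht k).1) h
  · exact hinf (fiber Gᶜ t) (fun k => (ht k).2) h

open IsSaturatedGeometric in
/-- An `A`-definable subset of `K ^ n` contains all or none of the `A`-independent tuples. -/
theorem mem_of_tupleDim_eq (hM : IsMinimal L K) (hK : IsSaturatedGeometric L K) {n : ℕ}
    {Y : Set (Fin n → K)} (hY : A.Definable L Y) {y z : Fin n → K} (hy : y ∈ Y)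
    (hyn : tupleDim L A y = n) (hzn : tupleDim L A z = n) : z ∈ Y := by
  induction n with
  | zero => exact Subsingleton.elim y z ▸ hy
  | succ n ih =>
    obtain ⟨hy1, hy2⟩ := tupleDim_split_eq hK.exchange hyn
    obtain ⟨hz1, hz2⟩ := tupleDim_split_eq hK.exchange hzn
    have hG : A.Definable L (splitSet Y) := hY.preimage_comp _
    -- Having an infinite fibre passes from the tail of y to that of z by induction. By minimality
    -- that fibre is cofinite, so its finite complement cannot contain the head of z, which is
    -- generic over the tail.
    have hinf := ih (hK.definable_infinite_fiber hG)
      (infinite_of_tupleDim_eq_one hK.exchange hy2 (definable_fiber hG _)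
        ((mem_fiber_splitSet Y y).2 hy)) hy1 hz1
    rw [← mem_fiber_splitSet]
    by_contra hzY
    rcases hM.finite_or_compl_finite _ _ (definable_fiber hG (z ∘ finSuccSplit n ∘ Sum.inr))
      with h | h
    · exact hinf h
    · exact infinite_of_tupleDim_eq_one hK.exchange hz2 (definable_fiber hG _).compl hzY h

end IsMinimal

end Minimal

/-! ### Definable relics -/

section Relic

variable {L : FirstOrder.Language.{u, v}} {K : Type w} [L.Structure K] {A₀ : Set K} {d : ℕ}
  {M : Set (Fin d → K)} {L' : FirstOrder.Language.{u', v'}} [L'.Structure M]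

theorem flat_injective {ι : Type} : Function.Injective (flat : (ι → M) → ι × Fin d → K) :=
  fun _ _ h => funext fun i => Subtype.ext (funext fun k => congrFun h (i, k))

theorem coords_union_range {κ : Type} (A : Set M) (b : κ → M) :
    coords (A ∪ range b) = coords A ∪ range (flat b) := by
  ext k
  constructor
  · rintro ⟨a, ha | ⟨j, rfl⟩, i, rfl⟩
    · exact Or.inl ⟨a, ha, i, rfl⟩
    · exact Or.inr ⟨(j, i), rfl⟩
  · rintro (⟨a, ha, i, rfl⟩ | ⟨⟨j, i⟩, rfl⟩)
    · exact ⟨a, Or.inl ha, i, rfl⟩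
    · exact ⟨b j, Or.inr ⟨j, rfl⟩, i, rfl⟩

theorem union_coords_union_range {κ : Type} (A : Set M) (b : κ → M) :
    A₀ ∪ coords (A ∪ range b) = A₀ ∪ coords A ∪ range (flat b) := by
  rw [coords_union_range, union_assoc]

theorem countable_coords {A : Set M} (hA : A.Countable) : (coords A).Countable := by
  have : coords A = ⋃ a ∈ A, range (a : Fin d → K) := by
    ext k
    simp only [coords, mem_ofPred_eq, mem_iUnion, mem_range, exists_prop]
    exact exists_congr fun a => and_congr_right fun _ => exists_congr fun i => eq_comm
  rw [this]
  exact hA.biUnion fun a _ => countable_range _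

theorem range_flat_sumElim {ι κ : Type} (x : ι → M) (t : κ → M) :
    range (flat (Sum.elim x t)) = range (Sum.elim (flat x) (flat t)) := by
  ext k
  constructor
  · rintro ⟨⟨i | j, l⟩, rfl⟩
    · exact ⟨Sum.inl (i, l), rfl⟩
    · exact ⟨Sum.inr (j, l), rfl⟩
  · rintro ⟨⟨i, l⟩ | ⟨j, l⟩, rfl⟩
    · exact ⟨(Sum.inl i, l), rfl⟩
    · exact ⟨(Sum.inr j, l), rfl⟩

theorem flatGraph_eq_image {ι κ : Type} (C : Set (ι ⊕ κ → M)) :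
    flatGraph C = (fun g => g ∘ (Equiv.sumProdDistrib ι κ (Fin d)).symm) '' (flat '' C) := by
  have h : ∀ (x : ι → M) (t : κ → M), Sum.elim (flat x) (flat t) =
      flat (Sum.elim x t) ∘ (Equiv.sumProdDistrib ι κ (Fin d)).symm := by
    intro x t
    funext z
    rcases z with ⟨i, l⟩ | ⟨i, l⟩ <;> rfl
  ext z
  constructor
  · rintro ⟨x, t, hC, rfl⟩
    exact ⟨_, ⟨_, hC, rfl⟩, (h x t).symm⟩
  · rintro ⟨_, ⟨c, hC, rfl⟩, rfl⟩
    refine ⟨c ∘ Sum.inl, c ∘ Sum.inr, by rwa [Sum.elim_comp_inl_inr], ?_⟩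
    rw [h, Sum.elim_comp_inl_inr]

theorem sumElim_flat_mem_flatGraph_iff {ι κ : Type} {C : Set (ι ⊕ κ → M)} {x : ι → M}
    {t : κ → M} : Sum.elim (flat x) (flat t) ∈ flatGraph C ↔ Sum.elim x t ∈ C := by
  constructor
  · rintro ⟨x', t', h, he⟩
    have h1 : x = x' := flat_injective (funext fun i => congrFun he (Sum.inl i))
    have h2 : t = t' := flat_injective (funext fun i => congrFun he (Sum.inr i))
    rwa [h1, h2]
  · exact fun h => ⟨x, t, h, rfl⟩

/-! ### Transfer of definability, algebraicity and saturation from the relic -/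

namespace IsDefinableRelic

/-- A relic controls only sets definable without parameters in powers indexed by `Fin n`. The
parameters are therefore turned into variables, the indices renumbered, and `flat b` substituted
inside `K`. -/
theorem definable_image_flat (hR : IsDefinableRelic L A₀ M L') {ι : Type} [Finite ι] {A : Set M}
    {S : Set (ι → M)} (hS : A.Definable L' S) : (A₀ ∪ coords A).Definable L (flat '' S) := by
  obtain ⟨n, b, G, hb, hG, rfl⟩ := exists_tuple_of_definable hS
  let e : ι ⊕ Fin n ≃ Fin (Nat.card (ι ⊕ Fin n)) := Finite.equivFin _
  have h1 := hR.definable_of_definable _ _ (hG.preimage_comp e)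
  let f : Fin (Nat.card (ι ⊕ Fin n)) × Fin d → (ι × Fin d) ⊕ (Fin n × Fin d) :=
    fun p => Sum.map (fun i => (i, p.2)) (fun i => (i, p.2)) (e.symm p.1)
  have h2 := definable_fiber (h1.preimage_comp f) (flat b)
  have hf : ∀ (x : ι → M), Sum.elim (flat x) (flat b) ∘ f = flat (Sum.elim x b ∘ e.symm) := by
    intro x
    funext p
    simp only [f, Function.comp_apply, flat]
    rcases e.symm p.1 with i | i <;> rfl
  refine Eq.subst (motive := fun S => (A₀ ∪ coords A).Definable L S) ?_ (h2.mono ?_)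
  · ext z
    simp only [fiber, mem_ofPred_eq, mem_preimage, mem_image]
    constructor
    · rintro ⟨g, hg, h⟩
      have hz : z = flat (g ∘ e ∘ Sum.inl) := by
        funext p
        have := congrFun h (e (Sum.inl p.1), p.2)
        simp only [f, Function.comp_apply, Equiv.symm_apply_apply] at this
        exact this.symm
      have hgb : g ∘ e ∘ Sum.inr = b := by
        refine flat_injective (funext fun p => ?_)
        have := congrFun h (e (Sum.inr p.1), p.2)
        simp only [f, Function.comp_apply, Equiv.symm_apply_apply] at this
        exact this
      refine ⟨_, ?_, hz.symm⟩
      convert hg using 1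
      rw [← hgb]
      exact Sum.elim_comp_inl_inr (g ∘ e)
    · rintro ⟨x, hx, rfl⟩
      refine ⟨Sum.elim x b ∘ e.symm, ?_, (hf x).symm⟩
      rw [Function.comp_assoc, e.symm_comp_self]
      exact hx
  · refine union_subset_union_right _ ?_
    rintro _ ⟨p, rfl⟩
    exact ⟨b p.1, hb ⟨_, rfl⟩, p.2, rfl⟩

theorem definable_flatGraph (hR : IsDefinableRelic L A₀ M L') {ι κ : Type} [Finite ι] [Finite κ]
    {A : Set M} {C : Set (ι ⊕ κ → M)} (hC : A.Definable L' C) :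
    (A₀ ∪ coords A).Definable L (flatGraph C) := by
  rw [flatGraph_eq_image]
  exact (hR.definable_image_flat hC).image_comp_equiv _

theorem mem_acl (hR : IsDefinableRelic L A₀ M L') {A : Set M} {m : M} (hm : m ∈ acl L' A)
    (i : Fin d) : (m : Fin d → K) i ∈ acl L (A₀ ∪ coords A) := by
  obtain ⟨S, hS, hf, hmS⟩ := hm
  have hf' : {x : Fin 1 → M | x 0 ∈ S}.Finite :=
    hf.preimage (Equiv.funUnique (Fin 1) M).injective.injOn
  exact mem_acl_of_finite (hR.definable_image_flat hS) (hf'.image _)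
    (mem_image_of_mem flat (show (fun _ => m) ∈ {x : Fin 1 → M | x 0 ∈ S} from hmS)) (0, i)

theorem range_flat_subset_acl (hR : IsDefinableRelic L A₀ M L') {A : Set M} {ι : Type}
    {a : ι → M} (ha : range a ⊆ acl L' A) : range (flat a) ⊆ acl L (A₀ ∪ coords A) := by
  rintro _ ⟨p, rfl⟩
  exact hR.mem_acl (ha ⟨p.1, rfl⟩) p.2

theorem isAleph1Saturated (hR : IsDefinableRelic L A₀ M L') (hA₀ : A₀.Countable)
    (hne : Nonempty M) (hs : IsAleph1Saturated L K) : IsAleph1Saturated L' M := by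
  classical
  intro ι _ A hA F hF hfip
  rcases F.eq_empty_or_nonempty with rfl | ⟨S, hS⟩
  · exact ⟨fun _ => hne.some, by simp⟩
  obtain ⟨z, hz⟩ := hs (ι × Fin d) (A₀ ∪ coords A) (hA₀.union (countable_coords hA))
    (image flat '' F) (by
      rintro _ ⟨R, hR', rfl⟩
      exact hR.definable_image_flat (hF R hR')) (by
      intro G hG
      obtain ⟨G', hG', rfl⟩ := Finset.subset_set_image_iff.1 hG
      obtain ⟨x, hx⟩ := hfip G' hG'
      refine ⟨flat x, ?_⟩
      rintro R hR'
      obtain ⟨R, hRG, rfl⟩ := Finset.mem_image.1 hR'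
      exact ⟨x, hx R hRG, rfl⟩)
  obtain ⟨x, -, rfl⟩ := hz _ ⟨S, hS, rfl⟩
  exact ⟨x, fun R hR' => (flat_injective.mem_set_image).1 (hz _ ⟨R, hR', rfl⟩)⟩

end IsDefinableRelic

variable (L A₀ M L')

/-- A relic, definable over a countable set and minimal, of a saturated geometric structure. -/
structure IsMinimalRelic : Prop where
  geometric : IsSaturatedGeometric L K
  countable : A₀.Countable
  relic : IsDefinableRelic L A₀ M L'
  minimal : IsMinimal L' M

variable {L A₀ M L'}

/-! ### Comparison of rank in the relic with dimension in the ambient structure -/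

namespace IsMinimalRelic

open IsSaturatedGeometric (finSuccSplit)

theorem isSaturatedGeometric (h : IsMinimalRelic L A₀ M L') : IsSaturatedGeometric L' M :=
  h.minimal.isSaturatedGeometric (h.relic.isAleph1Saturated h.countable
    h.minimal.infinite.nonempty h.geometric.saturated)

theorem exchange (h : IsMinimalRelic L A₀ M L') : HasExchange L K := h.geometric.exchange

theorem countable_union (h : IsMinimalRelic L A₀ M L') {A : Set M} (hA : A.Countable) :
    (A₀ ∪ coords A).Countable := h.countable.union (countable_coords hA)

theorem one_le_setDim (h : IsMinimalRelic L A₀ M L') : 1 ≤ setDim L M :=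
  h.geometric.one_le_setDim h.countable h.relic.definable_universe
    (infinite_coe_iff.1 h.minimal.infinite)

theorem tupleDim_flat_sumElim (hE : HasExchange L K) {ι κ : Type} [Finite ι] [Finite κ]
    (B : Set K) (x : ι → M) (t : κ → M) : tupleDim L B (flat (Sum.elim x t)) =
      tupleDim L B (flat t) + tupleDim L (B ∪ range (flat t)) (flat x) := by
  rw [← tupleDim_sumElim hE]
  exact tupleDim_congr hE (range_flat_sumElim x t)

theorem tupleDim_flat_comp_equiv (hE : HasExchange L K) {ι κ : Type} [Finite ι] [Finite κ]
    (B : Set K) (x : ι → M) (e : κ ≃ ι) :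
    tupleDim L B (flat (x ∘ e)) = tupleDim L B (flat x) :=
  tupleDim_comp_equiv hE B (flat x) (Equiv.prodCongr e (Equiv.refl _))

theorem tupleDim_flat_const (hE : HasExchange L K) (B : Set K) (x : Fin 1 → M) :
    tupleDim L B (flat x) = tupleDim L B (x 0 : Fin d → K) := by
  refine tupleDim_congr hE (Subset.antisymm ?_ ?_)
  · rintro _ ⟨⟨i, l⟩, rfl⟩
    rw [Subsingleton.elim i 0]
    exact ⟨l, rfl⟩
  · rintro _ ⟨l, rfl⟩
    exact ⟨(0, l), rfl⟩

theorem tupleDim_flat_le_mul (h : IsMinimalRelic L A₀ M L') {n : ℕ} {B : Set K} (hB : A₀ ⊆ B)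
    (b : Fin n → M) : tupleDim L B (flat b) ≤ n * setDim L M := by
  induction n with
  | zero => simpa using tupleDim_le_natCard h.exchange B (flat b)
  | succ n ih =>
    have hb : Sum.elim (b ∘ finSuccSplit n ∘ Sum.inl) (b ∘ finSuccSplit n ∘ Sum.inr) =
        b ∘ finSuccSplit n := Sum.elim_comp_inl_inr (b ∘ finSuccSplit n)
    rw [← tupleDim_flat_comp_equiv h.exchange B b (finSuccSplit n), ← hb,
      tupleDim_flat_sumElim h.exchange, tupleDim_flat_const h.exchange, add_mul, one_mul]
    refine add_le_add (ih _) ((tupleDim_mono h.exchange ?_ _).trans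
      (h.geometric.tupleDim_le_setDim h.countable h.relic.definable_universe
        ((b ∘ finSuccSplit n ∘ Sum.inl) 0).2))
    exact hB.trans (subset_union_left.trans (subset_acl _))

theorem exists_tupleDim_flat_eq (h : IsMinimalRelic L A₀ M L') (n : ℕ) {B : Set K}
    (hBc : B.Countable) (hB : A₀ ⊆ B) :
    ∃ b : Fin n → M, tupleDim L B (flat b) = n * setDim L M := by
  induction n with
  | zero =>
    refine ⟨Fin.elim0, ?_⟩
    simpa using tupleDim_le_natCard h.exchange B (flat (Fin.elim0 : Fin 0 → M))
  | succ n ih =>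
    obtain ⟨b, hb⟩ := ih
    obtain ⟨m, hm, hmd⟩ := h.geometric.exists_isGeneric (A := B ∪ range (flat b))
      (hBc.union (countable_range _))
      (h.relic.definable_universe.mono (hB.trans subset_union_left))
      (nonempty_coe_sort.1 h.minimal.infinite.nonempty)
    refine ⟨Sum.elim (fun _ => ⟨m, hm⟩) b ∘ (finSuccSplit n).symm, ?_⟩
    rw [tupleDim_flat_comp_equiv h.exchange, tupleDim_flat_sumElim h.exchange,
      tupleDim_flat_const h.exchange, hb, hmd, add_mul, one_mul]

/-- A tuple of rank r is algebraic over r of its entries, each contributing at most the dimension of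
`M`. -/
theorem tupleDim_flat_le (h : IsMinimalRelic L A₀ M L') {ι : Type} [Finite ι] (A : Set M)
    (a : ι → M) : tupleDim L (A₀ ∪ coords A) (flat a) ≤ tupleDim L' A a * setDim L M := by
  obtain ⟨e, he⟩ := exists_comp_tupleDim h.isSaturatedGeometric.exchange A a
  refine (tupleDim_le_of_range_subset h.exchange (b := flat (a ∘ e)) ?_).trans
    (h.tupleDim_flat_le_mul subset_union_left _)
  rw [← union_coords_union_range]
  exact h.relic.range_flat_subset_acl he

/-- For the lower bound, project S to r = rk(S) coordinates independent at a generic point. A tuple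
z of `M ^ r` of the largest possible dimension in `K` has rank r, so by minimality it lies in the
projection; any lift of z to S has the required dimension. -/
theorem setDim_image_flat (h : IsMinimalRelic L A₀ M L') {ι : Type} [Finite ι] {A : Set M}
    (hA : A.Countable) {S : Set (ι → M)} (hS : A.Definable L' S) :
    setDim L (flat '' S) = setDim L' S * setDim L M := by
  have hM := h.isSaturatedGeometric
  have hB := h.countable_union hA
  refine le_antisymm ?_ ?_
  · refine h.geometric.setDim_le hB (h.relic.definable_image_flat hS) ?_
    rintro _ ⟨x, hx, rfl⟩
    exact (h.tupleDim_flat_le A x).trans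
      (Nat.mul_le_mul_right _ (hM.tupleDim_le_setDim hA hS hx))
  · rcases S.eq_empty_or_nonempty with rfl | hne
    · rw [IsSaturatedGeometric.setDim_empty, zero_mul]
      exact Nat.zero_le _
    obtain ⟨a, ha, had⟩ := hM.exists_isGeneric hA hS hne
    obtain ⟨e, he⟩ := exists_comp_tupleDim hM.exchange A a
    have hae : tupleDim L' A (a ∘ e) = tupleDim L' A a :=
      le_antisymm (tupleDim_comp_le hM.exchange A a e) (tupleDim_le_of_range_subset hM.exchange he)
    obtain ⟨z, hz⟩ := h.exists_tupleDim_flat_eq (tupleDim L' A a) hB subset_union_left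
    have hz' : tupleDim L' A z = tupleDim L' A a := by
      refine le_antisymm ?_ ?_
      · simpa using tupleDim_le_natCard hM.exchange A z
      · exact Nat.le_of_mul_le_mul_right (hz.ge.trans (h.tupleDim_flat_le A z)) h.one_le_setDim
    obtain ⟨b, hb, rfl⟩ := h.minimal.mem_of_tupleDim_eq hM (hS.image_comp e)
      ⟨a, ha, rfl⟩ hae hz'
    rw [← had, ← hz]
    refine le_trans ?_ (h.geometric.tupleDim_le_setDim hB (h.relic.definable_image_flat hS)
      ⟨b, hb, rfl⟩)
    exact tupleDim_comp_le h.exchange _ (flat b) (Prod.map e id)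

end IsMinimalRelic

end Relic

/-! ### Standard families of plane curves -/

section Curves

variable {L : FirstOrder.Language.{u, v}} {K : Type w} [L.Structure K]

theorem definable_params_through {ι κ : Type} {A : Set K} {C : Set (ι ⊕ κ → K)}
    (hC : A.Definable L C) (x : ι → K) :
    (A ∪ range x).Definable L {t | Sum.elim x t ∈ C} := by
  convert definable_fiber (hC.preimage_comp Sum.swap) x using 1
  ext t
  refine iff_of_eq (congrArg (· ∈ C) ?_)
  funext z
  rcases z with z | z <;> rfl

theorem IsSaturatedGeometric.infinite_of_setDim_eq_one (hK : IsSaturatedGeometric L K) {ι : Type}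
    [Finite ι] {A : Set K} (hA : A.Countable) {X : Set (ι → K)} (hX : A.Definable L X)
    (h : setDim L X = 1) : X.Infinite := fun hf => by
  rw [hK.setDim_eq_zero_of_finite hA hX hf] at h
  exact zero_ne_one h

namespace IsAlmostFaithfulCurves

variable {n : ℕ} {A : Set K} {T : Set (Fin n → K)} {C : Set (Fin 2 ⊕ Fin n → K)}

theorem definable_inter (h : IsAlmostFaithfulCurves L A T C) (t t' : Fin n → K) :
    (A ∪ range t ∪ range t').Definable L (fiber C t ∩ fiber C t') :=
  ((definable_fiber h.family.definable_graph t).mono subset_union_left).inter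
    ((definable_fiber h.family.definable_graph t').mono
      (union_subset_union_left _ subset_union_left))

theorem setDim_inter_eq_one_iff (hK : IsSaturatedGeometric L K)
    (h : IsAlmostFaithfulCurves L A T C) (hA : A.Countable) {t t' : Fin n → K} (ht : t ∈ T) :
    setDim L (fiber C t ∩ fiber C t') = 1 ↔ (fiber C t ∩ fiber C t').Infinite := by
  have hc : (A ∪ range t ∪ range t').Countable :=
    (hA.union (countable_range _)).union (countable_range _)
  refine ⟨hK.infinite_of_setDim_eq_one hc (h.definable_inter t t'), fun hinf => le_antisymm ?_
    (hK.one_le_setDim hc (h.definable_inter t t') hinf)⟩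
  rw [← h.curve t ht]
  exact hK.setDim_mono hc (h.definable_inter t t')
    ((definable_fiber h.family.definable_graph t).mono subset_union_left) inter_subset_left

theorem infinite_fiber (hK : IsSaturatedGeometric L K) (h : IsAlmostFaithfulCurves L A T C)
    (hA : A.Countable) {t : Fin n → K} (ht : t ∈ T) : (fiber C t).Infinite :=
  hK.infinite_of_setDim_eq_one (hA.union (countable_range t))
    (definable_fiber h.family.definable_graph t) (h.curve t ht)

end IsAlmostFaithfulCurves

/-- A rank `2` almost faithful family can be reparametrized by a subset of the plane. -/
theorem IsNonLocallyModular.exists_plane_params (hK : IsSaturatedGeometric L K)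
    (h : IsNonLocallyModular L K) :
    ∃ (A : Set K) (T : Set (Fin 2 → K)) (C : Set (Fin 2 ⊕ Fin 2 → K)),
      A.Countable ∧ IsAlmostFaithfulCurves L A T C ∧ setDim L T = 2 := by
  obtain ⟨A, n, T, C, hA, hTC, hT2⟩ := h
  have hTne : T.Nonempty := by
    by_contra hne
    rw [not_nonempty_iff_eq_empty.1 hne, IsSaturatedGeometric.setDim_empty] at hT2
    exact absurd hT2 (by norm_num)
  obtain ⟨t, htT, ht2⟩ := hK.exists_isGeneric hA hTC.family.definable_params hTne
  rw [hT2] at ht2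
  obtain ⟨e, he⟩ : ∃ e : Fin 2 → Fin n, range t ⊆ acl L (A ∪ range (t ∘ e)) := by
    have := exists_comp_tupleDim hK.exchange A t
    rwa [ht2] at this
  have hte : tupleDim L A (t ∘ e) = 2 :=
    le_antisymm (by simpa using tupleDim_le_natCard hK.exchange A (t ∘ e))
      (ht2.ge.trans (tupleDim_le_of_range_subset hK.exchange he))
  choose G hG hGf hGt using fun l => mem_acl_union_range_iff.1 (he ⟨l, rfl⟩)
  -- Parameters whose entries are algebraic over the two chosen coordinates by the same formulas as
  -- for t. The projection of this set to the plane is finite-to-one.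
  let T₁ : Set (Fin n → K) := T ∩ ⋂ l, ({t | (fiber (G l) (t ∘ e)).Infinite}ᶜ ∩
    {t | (fun _ => t l) ∈ fiber (G l) (t ∘ e)})
  have hT₁ : A.Definable L T₁ := by
    refine hTC.family.definable_params.inter (definable_iInter_of_finite fun l =>
      ((hK.definable_infinite_fiber (hG l)).preimage_comp e).compl.inter ?_)
    convert (hG l).preimage_comp (Sum.elim (fun _ => l) e) using 1
    ext s
    refine iff_of_eq (congrArg (· ∈ G l) ?_)
    funext z
    rcases z with z | z <;> rfl
  have hT₁mem : ∀ s ∈ T₁, ∀ l, (fiber (G l) (s ∘ e)).Finite ∧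
      (fun _ => s l) ∈ fiber (G l) (s ∘ e) := fun s hs l =>
    ⟨not_infinite.1 (mem_iInter.1 hs.2 l).1, (mem_iInter.1 hs.2 l).2⟩
  have htT₁ : t ∈ T₁ := ⟨htT, mem_iInter.2 fun l => ⟨not_infinite.2 (hGf l), hGt l⟩⟩
  have hT₁fin : ∀ s, {t ∈ T₁ | t ∘ e = s}.Finite := by
    intro s
    by_cases hs : ∀ l, (fiber (G l) s).Finite
    · refine (Finite.pi' fun l => (hs l).image fun y => y 0).subset ?_
      rintro t ⟨ht, rfl⟩ l
      exact ⟨_, (hT₁mem t ht l).2, rfl⟩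
    · convert finite_empty
      refine eq_empty_of_forall_notMem ?_
      rintro t ⟨ht, rfl⟩
      exact hs fun l => (hT₁mem t ht l).1
  have hT₁acl : ∀ s ∈ T₁, range s ⊆ acl L (A ∪ range (s ∘ e)) := by
    rintro s hs _ ⟨l, rfl⟩
    exact mem_acl_union_range_iff.2 ⟨G l, hG l, hT₁mem s hs l⟩
  -- The new curve at s is the union of the finitely many old curves whose parameter projects to s.
  let C₁ : Set (Fin 2 ⊕ Fin 2 → K) := (fun g => g ∘ Sum.map id e) ''
    (C ∩ (fun w => w ∘ Sum.inr) ⁻¹' T₁)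
  have hC₁ : A.Definable L C₁ :=
    (hTC.family.definable_graph.inter (hT₁.preimage_comp _)).image_comp _
  have hC₁mem : ∀ x s, Sum.elim x s ∈ C₁ ↔ ∃ t ∈ T₁, t ∘ e = s ∧ Sum.elim x t ∈ C := by
    intro x s
    constructor
    · rintro ⟨g, ⟨hgC, hgT⟩, h⟩
      refine ⟨g ∘ Sum.inr, hgT, ?_, ?_⟩
      · funext i
        exact congrFun h (Sum.inr i)
      · convert hgC
        have : x = g ∘ Sum.inl := by
          funext i
          exact (congrFun h (Sum.inl i)).symm
        rw [this, Sum.elim_comp_inl_inr]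
    · rintro ⟨t, ht, rfl, hC⟩
      refine ⟨Sum.elim x t, ⟨hC, ht⟩, ?_⟩
      funext z
      rcases z with z | z <;> rfl
  have hsub : ∀ t ∈ T₁, fiber C t ⊆ fiber C₁ (t ∘ e) := fun t ht x hx =>
    (hC₁mem _ _).2 ⟨t, ht, rfl, hx⟩
  have hT₂ : A.Definable L ((fun g => g ∘ e) '' T₁) := hT₁.image_comp e
  have hcount : ∀ {m : ℕ} (s : Fin m → K), (A ∪ range s).Countable := fun s =>
    hA.union (countable_range s)
  refine ⟨A, (fun g => g ∘ e) '' T₁, C₁, hA, ⟨⟨hT₂, hC₁, ?_⟩, ?_, ?_⟩, le_antisymm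
    (hK.setDim_le hA hT₂ fun s _ => by simpa using tupleDim_le_natCard hK.exchange A s)
    (hte.ge.trans (hK.tupleDim_le_setDim hA hT₂ ⟨t, htT₁, rfl⟩))⟩
  · intro x s hxs
    obtain ⟨t, ht, rfl, -⟩ := (hC₁mem _ _).1 hxs
    exact ⟨mem_univ _, t, ht, rfl⟩
  · rintro _ ⟨t, ht, rfl⟩
    refine le_antisymm ?_ ?_
    · refine hK.setDim_le (hcount _) (definable_fiber hC₁ _) fun x hx => ?_
      obtain ⟨t', ht', hte', hx'⟩ := (hC₁mem _ _).1 hx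
      refine (tupleDim_mono hK.exchange (A := A ∪ range t') ?_ x).trans ?_
      · refine union_subset (subset_union_left.trans (subset_acl _)) ?_
        rw [← hte']
        exact hT₁acl t' ht'
      · rw [← hTC.curve t' ht'.1]
        exact hK.tupleDim_le_setDim (hcount _)
          (definable_fiber hTC.family.definable_graph t') hx'
    · exact hK.one_le_setDim (hcount _) (definable_fiber hC₁ _)
        ((hTC.infinite_fiber hK hA ht.1).mono (hsub t ht))
  · rintro s -
    refine ((hT₁fin s).biUnion (t := fun t => (fun g => g ∘ e) ''
      {t' ∈ T | t ∈ T₁ ∧ setDim L (fiber C t ∩ fiber C t') = 1}) fun t ht =>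
        ((hTC.almost_faithful t ht.1.1).subset fun t' ht' => ⟨ht'.1, ht'.2.2⟩).image _).subset ?_
    rintro _ ⟨⟨t₀, ht₀, rfl⟩, hdim⟩
    have hd : ((A ∪ range s) ∪ range (t₀ ∘ e)).Definable L
        (fiber C₁ s ∩ fiber C₁ (t₀ ∘ e)) :=
      ((definable_fiber hC₁ _).mono subset_union_left).inter
        ((definable_fiber hC₁ _).mono (union_subset_union_left _ subset_union_left))
    have hinf := hK.infinite_of_setDim_eq_one ((hcount s).union (countable_range _)) hd hdim
    -- If two finite unions of curves meet in an infinite set, so do two of their members; this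
    -- carries almost faithfulness over to the new family.
    have hun : fiber C₁ s ∩ fiber C₁ (t₀ ∘ e) ⊆ ⋃ t ∈ {t ∈ T₁ | t ∘ e = s},
        ⋃ t' ∈ {t ∈ T₁ | t ∘ e = t₀ ∘ e}, fiber C t ∩ fiber C t' := by
      rintro x ⟨h1, h2⟩
      obtain ⟨t, ht, hts, hxt⟩ := (hC₁mem _ _).1 h1
      obtain ⟨t', ht', hts', hxt'⟩ := (hC₁mem _ _).1 h2
      exact mem_biUnion (show t ∈ {t ∈ T₁ | t ∘ e = s} from ⟨ht, hts⟩)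
        (mem_biUnion (show t' ∈ {t ∈ T₁ | t ∘ e = t₀ ∘ e} from ⟨ht', hts'⟩) ⟨hxt, hxt'⟩)
    by_contra hnot
    refine hinf (((hT₁fin s).biUnion fun t ht => (hT₁fin _).biUnion fun t' ht' => ?_).subset hun)
    by_contra hi
    refine hnot (mem_biUnion ht ⟨t', ⟨ht'.1.1, ht.1, ?_⟩, ht'.2⟩)
    exact (hTC.setDim_inter_eq_one_iff hK hA ht.1.1).2 hi

/-- Only finitely many points lie on generic curves of a plane family of rank `2`. -/
theorem IsAlmostFaithfulCurves.finite_setOf_two_le_setDim (hK : IsSaturatedGeometric L K)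
    (hM : IsMinimal L K) {A : Set K} (hA : A.Countable) {T : Set (Fin 2 → K)}
    {C : Set (Fin 2 ⊕ Fin 2 → K)} (h : IsAlmostFaithfulCurves L A T C) (hT : setDim L T = 2) :
    {x | 2 ≤ setDim L {t | Sum.elim x t ∈ C}}.Finite := by
  by_contra hinf
  let f := Set.Infinite.natEmbedding _ hinf
  -- Countably many exceptional points suffice for an infinite intersection, and the parameter set
  -- stays countable.
  let A₁ : Set K := A ∪ ⋃ k, range (f k : Fin 2 → K)
  have hA₁ : A₁.Countable := hA.union (countable_iUnion fun k => countable_range _)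
  have hTne : T.Nonempty := by
    by_contra hne
    rw [not_nonempty_iff_eq_empty.1 hne, IsSaturatedGeometric.setDim_empty] at hT
    exact absurd hT (by norm_num)
  have hgen : ∀ B : Set K, B.Countable → A ⊆ B → ∃ t ∈ T, tupleDim L B t = 2 := fun B hB hAB => by
    obtain ⟨t, ht, htd⟩ := hK.exists_isGeneric hB (h.family.definable_params.mono hAB) hTne
    exact ⟨t, ht, htd.trans hT⟩
  have hmem : ∀ t : Fin 2 → K, tupleDim L A₁ t = 2 → ∀ k, Sum.elim (f k : Fin 2 → K) t ∈ C := by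
    intro t ht k
    have hd : A₁.Definable L {t | Sum.elim (f k : Fin 2 → K) t ∈ C} :=
      (definable_params_through h.family.definable_graph (f k : Fin 2 → K)).mono
        (union_subset_union_right _ (subset_iUnion (fun k => range (f k : Fin 2 → K)) k))
    have h2 : 2 ≤ setDim L {t | Sum.elim (f k : Fin 2 → K) t ∈ C} := (f k).2
    obtain ⟨y, hy, hyd⟩ := hK.exists_isGeneric hA₁ hd (by
      by_contra hne
      rw [not_nonempty_iff_eq_empty.1 hne, IsSaturatedGeometric.setDim_empty] at h2
      exact absurd h2 (by norm_num))
    have hy2 : tupleDim L A₁ y = 2 :=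
      le_antisymm (by simpa using tupleDim_le_natCard hK.exchange A₁ y) (hyd ▸ h2)
    exact hM.mem_of_tupleDim_eq hK hd hy hy2 ht
  obtain ⟨t, htT, ht⟩ := hgen A₁ hA₁ subset_union_left
  have hF := h.almost_faithful t htT
  -- A t' generic over this set is not among the finitely many parameters whose curves meet C_t
  -- infinitely often; yet C_t and C_t' share all the chosen exceptional points.
  let A₂ : Set K := A₁ ∪ ⋃ t' ∈ {t' ∈ T | setDim L (fiber C t ∩ fiber C t') = 1}, range t'
  have hA₂ : A₂.Countable := hA₁.union (hF.countable.biUnion fun t' _ => countable_range t')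
  obtain ⟨t', htT', ht'⟩ := hgen A₂ hA₂ (subset_union_left.trans subset_union_left)
  have ht'₁ : tupleDim L A₁ t' = 2 :=
    le_antisymm (by simpa using tupleDim_le_natCard hK.exchange A₁ t')
      (ht'.ge.trans (tupleDim_mono hK.exchange (subset_union_left.trans (subset_acl _)) t'))
  have hdim : setDim L (fiber C t ∩ fiber C t') = 1 := by
    rw [h.setDim_inter_eq_one_iff hK hA htT]
    refine (infinite_range_of_injective (Subtype.val_injective.comp f.injective)).mono ?_
    rintro _ ⟨k, rfl⟩
    exact ⟨hmem t ht k, hmem t' ht'₁ k⟩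
  have h0 : tupleDim L A₂ t' = 0 := by
    rw [tupleDim_eq_zero_iff hK.exchange]
    exact (subset_union_of_subset_right (subset_biUnion_of_mem (u := fun t' => range t')
      (show t' ∈ {t' ∈ T | setDim L (fiber C t ∩ fiber C t') = 1} from ⟨htT', hdim⟩)) _).trans
      (subset_acl _)
  omega

theorem definable_of_finite {ι : Type} [Finite ι] {A : Set K} {S : Set (ι → K)} (hS : S.Finite)
    (h : ∀ x ∈ S, range x ⊆ A) : A.Definable L S := by
  have hsingle : ∀ x ∈ S, A.Definable L {x} := by
    intro x hx
    have : ({x} : Set (ι → K)) = ⋂ i, {y | y i ∈ ({x i} : Set K)} := by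
      ext y
      simp [funext_iff]
    rw [this]
    exact definable_iInter_of_finite fun i =>
      definable_preimage₁ (Definable.singleton_of_mem L (h x hx ⟨i, rfl⟩)) i
  have hU := definable_biUnion_finset (A := A) (L := L) (f := fun x : S => {(x : ι → K)})
    (fun x => hsingle x x.2) (@Finset.univ S hS.fintype)
  convert hU using 1
  ext x
  simp

/-- A non-locally modular minimal structure has a standard family with parameters in the plane. -/
theorem IsNonLocallyModular.exists_isStandardFamily (hK : IsSaturatedGeometric L K)
    (hM : IsMinimal L K) (h : IsNonLocallyModular L K) :
    ∃ (A : Set K) (T : Set (Fin 2 → K)) (C : Set (Fin 2 ⊕ Fin 2 → K)),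
      A.Countable ∧ IsStandardFamily L A T C := by
  obtain ⟨A, T, C, hA, hTC, hT⟩ := h.exists_plane_params hK
  have hE := hTC.finite_setOf_two_le_setDim hK hM hA hT
  set E := {x | 2 ≤ setDim L {t | Sum.elim x t ∈ C}} with hEdef
  let A₁ : Set K := A ∪ ⋃ x ∈ E, range x
  have hAA₁ : A ⊆ A₁ := subset_union_left
  have hA₁ : A₁.Countable := hA.union (hE.countable.biUnion fun x _ => countable_range x)
  have hEd : A₁.Definable L E := definable_of_finite hE fun x hx =>
    subset_union_of_subset_right (subset_biUnion_of_mem (u := fun x => range x) hx) _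
  -- Removing finitely many points leaves every curve of rank 1 and creates no new infinite
  -- intersection, while no curve passes any more through an exceptional point.
  let C₁ : Set (Fin 2 ⊕ Fin 2 → K) := C \ (fun w => w ∘ Sum.inl) ⁻¹' E
  have hC₁ : A₁.Definable L C₁ :=
    (hTC.family.definable_graph.mono hAA₁).sdiff (hEd.preimage_comp _)
  have hfib : ∀ t, fiber C₁ t = fiber C t \ E := fun t => rfl
  have hcount : ∀ {m : ℕ} (s : Fin m → K), (A₁ ∪ range s).Countable := fun s =>
    hA₁.union (countable_range s)
  have hCd : ∀ t, (A₁ ∪ range t).Definable L (fiber C t) := fun t =>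
    (definable_fiber hTC.family.definable_graph t).mono (union_subset_union_left _ hAA₁)
  refine ⟨A₁, T, C₁, hA₁, ⟨⟨⟨hTC.family.definable_params.mono hAA₁, hC₁, fun x t hx =>
    hTC.family.subset x t hx.1⟩, fun t ht => le_antisymm ?_ ?_, fun t ht => ?_⟩,
    one_le_two, hT, fun x => ?_⟩⟩
  · rw [← hTC.curve t ht]
    exact hK.setDim_mono (hcount t) (definable_fiber hC₁ t) (hCd t) sdiff_subset
  · exact hK.one_le_setDim (hcount t) (definable_fiber hC₁ t)
      ((hTC.infinite_fiber hK hA ht).sdiff hE)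
  · refine (hTC.almost_faithful t ht).subset fun t' ht' => ⟨ht'.1, ?_⟩
    rw [hTC.setDim_inter_eq_one_iff hK hA ht]
    refine (hK.infinite_of_setDim_eq_one ((hcount t).union (countable_range t')) ?_ ht'.2).mono
      (inter_subset_inter sdiff_subset sdiff_subset)
    exact ((definable_fiber hC₁ t).mono subset_union_left).inter ((definable_fiber hC₁ t').mono
      (union_subset_union_left _ subset_union_left))
  · by_cases hx : x ∈ E
    · have : {t | Sum.elim x t ∈ C₁} = ∅ := eq_empty_of_forall_notMem fun t ht => ht.2 hx
      rw [this, IsSaturatedGeometric.setDim_empty]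
      exact two_pos
    · have : {t | Sum.elim x t ∈ C₁} = {t | Sum.elim x t ∈ C} := by
        ext t
        exact ⟨fun ht => ht.1, fun ht => ⟨ht, hx⟩⟩
      rw [this]
      exact not_le.1 hx

end Curves

/-! ### The diagonal of a standard family, seen in the ambient structure -/

/-- As x is algebraic over Ay, adjoining it to y does not raise the dimension; additivity, with x
taken first, then gives the bound. -/
theorem tupleDim_add_le_of_range_subset_acl {L : FirstOrder.Language.{u, v}} {K : Type w}
    [L.Structure K] (hE : HasExchange L K) {ι κ : Type} [Finite ι] [Finite κ] {A : Set K}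
    {x : ι → K} {y : κ → K} (h : range x ⊆ acl L (A ∪ range y)) :
    tupleDim L A x + tupleDim L (A ∪ range x) y ≤ tupleDim L A y := by
  rw [← tupleDim_sumElim' hE]
  refine tupleDim_le_of_range_subset hE ?_
  rw [Sum.elim_range]
  exact union_subset h (subset_union_right.trans (subset_acl _))

namespace IsStandardFamily

/-! ### Ranks of points and parameters within the relic -/

section Rank

variable {L : FirstOrder.Language.{u, v}} {M : Type w} [L.Structure M] {A : Set M}
  {T : Set (Fin 2 → M)} {C : Set (Fin 2 ⊕ Fin 2 → M)} {x t u : Fin 2 → M}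

theorem tupleDim_point_le (hS : IsStandardFamily L A T C) (hM : IsSaturatedGeometric L M)
    (hA : A.Countable) (h : Sum.elim x t ∈ C) : tupleDim L (A ∪ range t) x ≤ 1 := by
  rw [← hS.curve t (hS.family.subset x t h).2]
  exact hM.tupleDim_le_setDim (hA.union (countable_range t))
    (definable_fiber hS.family.definable_graph t) h

theorem tupleDim_param_le (hS : IsStandardFamily L A T C) (hM : IsSaturatedGeometric L M)
    (hA : A.Countable) (h : Sum.elim x t ∈ C) : tupleDim L (A ∪ range x) t ≤ 1 :=
  Nat.le_of_lt_succ ((hM.tupleDim_le_setDim (hA.union (countable_range x))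
    (definable_params_through hS.family.definable_graph x) h).trans_lt (hS.rank_through x))

theorem setDim_univ (hS : IsStandardFamily L A T C) (hM : IsSaturatedGeometric L M)
    (hA : A.Countable) : setDim L (univ : Set (Fin 2 → M)) = 2 :=
  le_antisymm (hM.setDim_le hA definable_univ fun x _ => by
      simpa using tupleDim_le_natCard hM.exchange A x)
    (hS.rank_eq.ge.trans
      (hM.setDim_mono hA hS.family.definable_params definable_univ (subset_univ T)))

theorem setDim_graph (hS : IsStandardFamily L A T C) (hM : IsSaturatedGeometric L M)
    (hA : A.Countable) : setDim L C = 3 := by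
  refine le_antisymm (hM.setDim_le hA hS.family.definable_graph fun c hc => ?_) ?_
  · rw [← Sum.elim_comp_inl_inr c] at hc ⊢
    rw [tupleDim_sumElim hM.exchange]
    exact add_le_add (by simpa using tupleDim_le_natCard hM.exchange A (c ∘ Sum.inr))
      (hS.tupleDim_point_le hM hA hc)
  · have hTne : T.Nonempty := by
      by_contra hne
      have := hS.rank_eq
      rw [not_nonempty_iff_eq_empty.1 hne, IsSaturatedGeometric.setDim_empty] at this
      exact absurd this (by norm_num)
    obtain ⟨t, ht, htd⟩ := hM.exists_isGeneric hA hS.family.definable_params hTne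
    obtain ⟨x, hx, hxd⟩ := hM.exists_isGeneric (hA.union (countable_range t))
      (definable_fiber hS.family.definable_graph t) (hS.infinite_fiber hM hA ht).nonempty
    have := hM.tupleDim_le_setDim hA hS.family.definable_graph hx
    rw [tupleDim_sumElim hM.exchange, htd, hxd, hS.rank_eq, hS.curve t ht] at this
    exact this

/-- If `t` and `u` have rank at least `2` over a common point `x` of their curves, then `x` is
one of the finitely many common points of these curves. -/
theorem range_subset_acl (hS : IsStandardFamily L A T C) (hM : IsSaturatedGeometric L M)
    (hA : A.Countable) (ht : Sum.elim x t ∈ C) (hu : Sum.elim x u ∈ C)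
    (h : 2 ≤ tupleDim L (A ∪ range x) (Sum.elim t u)) :
    range x ⊆ acl L (A ∪ range (Sum.elim t u)) := by
  have hC := hS.family.definable_graph
  let H : Set (Fin 2 ⊕ (Fin 2 ⊕ Fin 2) → M) :=
    (fun w => w ∘ Sum.map id Sum.inl) ⁻¹' C ∩ (fun w => w ∘ Sum.map id Sum.inr) ⁻¹' C
  have hH : A.Definable L H := (hC.preimage_comp _).inter (hC.preimage_comp _)
  have hfib : ∀ t u, fiber H (Sum.elim t u) = fiber C t ∩ fiber C u := by
    intro t u
    ext y
    refine iff_of_eq (congrArg₂ (fun p q => p ∈ C ∧ q ∈ C) ?_ ?_) <;>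
    · funext z
      rcases z with z | z <;> rfl
  by_cases hinf : (fiber C t ∩ fiber C u).Infinite
  -- Were the intersection infinite, u would be one of the finitely many parameters whose curves
  -- meet C_t infinitely often, hence algebraic over At. The pair would then have rank at most
  -- rk(t/Ax) ≤ 1.
  · exfalso
    have hd := definable_params_through (hM.definable_infinite_fiber hH) t
    have htT := (hS.family.subset x t ht).2
    have hd' := (hS.family.definable_params.mono (subset_union_left (t := range t))).inter hd
    have hfin : (T ∩ {u | Sum.elim t u ∈ {p | (fiber H p).Infinite}}).Finite := by
      refine (hS.almost_faithful t htT).subset fun u' hu' => ⟨hu'.1, ?_⟩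
      rw [hS.setDim_inter_eq_one_iff hM hA htT, ← hfib]
      exact hu'.2
    have hacl : range u ⊆ acl L (A ∪ range t) := by
      rintro _ ⟨i, rfl⟩
      refine mem_acl_of_finite hd' hfin ⟨(hS.family.subset x u hu).2, ?_⟩ i
      rw [mem_ofPred_eq, mem_ofPred_eq, hfib]
      exact hinf
    have h1 : tupleDim L (A ∪ range x) (Sum.elim t u) ≤ tupleDim L (A ∪ range x) t := by
      refine tupleDim_le_of_range_subset hM.exchange ?_
      rw [Sum.elim_range]
      exact union_subset (subset_union_right.trans (subset_acl _))
        (hacl.trans (acl_mono (union_subset_union_left _ subset_union_left)))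
    have h2 := hS.tupleDim_param_le hM hA ht
    omega
  · rw [← hfib] at hinf
    rintro _ ⟨i, rfl⟩
    refine mem_acl_of_finite (definable_fiber hH _) (not_infinite.1 hinf) ?_ i
    rw [hfib]
    exact ⟨ht, hu⟩

end Rank

/-! ### Dimensions in the ambient structure -/

section Ambient

variable {L : FirstOrder.Language.{u, v}} {K : Type w} [L.Structure K] {A₀ : Set K} {d : ℕ}
  {M : Set (Fin d → K)} {L' : FirstOrder.Language.{u', v'}} [L'.Structure M] {A : Set M}
  {T : Set (Fin 2 → M)} {C : Set (Fin 2 ⊕ Fin 2 → M)} {x t u : Fin 2 → M}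

theorem setDim_flatGraph (hS : IsStandardFamily L' A T C) (h : IsMinimalRelic L A₀ M L')
    (hA : A.Countable) : setDim L (flatGraph C) = 3 * setDim L M := by
  have hC := hS.family.definable_graph
  have hB := h.countable_union hA
  have hd := h.relic.definable_image_flat hC
  have hdim : ∀ x t : Fin 2 → M, tupleDim L (A₀ ∪ coords A) (Sum.elim (flat x) (flat t)) =
      tupleDim L (A₀ ∪ coords A) (flat (Sum.elim x t)) := fun x t =>
    (tupleDim_congr h.exchange (range_flat_sumElim x t)).symm
  rw [← hS.setDim_graph h.isSaturatedGeometric hA, ← h.setDim_image_flat hA hC]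
  refine le_antisymm (h.geometric.setDim_le hB (h.relic.definable_flatGraph hC) ?_)
    (h.geometric.setDim_le hB hd ?_)
  · rintro _ ⟨x, t, hxt, rfl⟩
    rw [hdim]
    exact h.geometric.tupleDim_le_setDim hB hd ⟨_, hxt, rfl⟩
  · rintro _ ⟨c, hc, rfl⟩
    rw [← Sum.elim_comp_inl_inr c] at hc ⊢
    rw [← hdim]
    exact h.geometric.tupleDim_le_setDim hB (h.relic.definable_flatGraph hC) ⟨_, _, hc, rfl⟩

theorem tupleDim_flat_param_le (hS : IsStandardFamily L' A T C) (h : IsMinimalRelic L A₀ M L')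
    (hA : A.Countable) (hC : Sum.elim x t ∈ C) :
    tupleDim L (A₀ ∪ coords A ∪ range (flat x)) (flat t) ≤ setDim L M := by
  rw [← union_coords_union_range]
  refine (h.tupleDim_flat_le _ t).trans ?_
  simpa using Nat.mul_le_mul_right (setDim L M)
    (hS.tupleDim_param_le h.isSaturatedGeometric hA hC)

theorem tupleDim_flat_point_le (hS : IsStandardFamily L' A T C) (h : IsMinimalRelic L A₀ M L')
    (hA : A.Countable) (hC : Sum.elim x t ∈ C) :
    tupleDim L (A₀ ∪ coords A ∪ range (flat t)) (flat x) ≤ setDim L M := by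
  rw [← union_coords_union_range]
  refine (h.tupleDim_flat_le _ x).trans ?_
  simpa using Nat.mul_le_mul_right (setDim L M)
    (hS.tupleDim_point_le h.isSaturatedGeometric hA hC)

/-- The dimensions of a generic point of the graph of a standard family. -/
theorem tupleDim_flat_eq (hS : IsStandardFamily L' A T C) (h : IsMinimalRelic L A₀ M L')
    (hA : A.Countable) (hC : Sum.elim x t ∈ C)
    (hdim : tupleDim L (A₀ ∪ coords A) (Sum.elim (flat x) (flat t)) = 3 * setDim L M) :
    tupleDim L (A₀ ∪ coords A) (flat x) = 2 * setDim L M ∧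
    tupleDim L (A₀ ∪ coords A) (flat t) = 2 * setDim L M ∧
    tupleDim L (A₀ ∪ coords A ∪ range (flat x)) (flat t) = setDim L M ∧
    tupleDim L (A₀ ∪ coords A ∪ range (flat t)) (flat x) = setDim L M := by
  have h1 := hS.tupleDim_flat_param_le h hA hC
  have h2 := hS.tupleDim_flat_point_le h hA hC
  have h3 := tupleDim_sumElim h.exchange (A₀ ∪ coords A) (flat x) (flat t)
  have h4 := tupleDim_sumElim' h.exchange (A₀ ∪ coords A) (flat x) (flat t)
  have h5 := h.tupleDim_flat_le_mul (B := A₀ ∪ coords A) subset_union_left x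
  have h6 := h.tupleDim_flat_le_mul (B := A₀ ∪ coords A) subset_union_left t
  -- Either splitting bounds 3δ by 2δ + δ, where δ is the dimension of `M`, so all the bounds are
  -- equalities.
  omega

theorem isGeneric_flatGraph (hS : IsStandardFamily L' A T C) (h : IsMinimalRelic L A₀ M L')
    (hA : A.Countable) (hC : Sum.elim x t ∈ C)
    (hdim : tupleDim L (A₀ ∪ coords A) (Sum.elim (flat x) (flat t)) = 3 * setDim L M) :
    IsGeneric L (A₀ ∪ coords A) (flatGraph C) (Sum.elim (flat x) (flat t)) :=
  ⟨⟨x, t, hC, rfl⟩, hdim.trans (hS.setDim_flatGraph h hA).symm⟩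

theorem isWeaklyGeneric (hS : IsStandardFamily L' A T C) (h : IsMinimalRelic L A₀ M L')
    (hA : A.Countable) (ht : Sum.elim x t ∈ C) (hu : Sum.elim x u ∈ C)
    (htd : tupleDim L (A₀ ∪ coords A) (Sum.elim (flat x) (flat t)) = 3 * setDim L M)
    (hud : tupleDim L (A₀ ∪ coords A) (Sum.elim (flat x) (flat u)) = 3 * setDim L M) :
    IsWeaklyGeneric L (A₀ ∪ coords A) (range (flat : (Fin 2 → M) → Fin 2 × Fin d → K))
      (flat '' T) (flat '' T) (flatGraph C) (flatGraph C) (flat x) (flat t) (flat u) := by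
  have hT : setDim L (flat '' T) = 2 * setDim L M := by
    rw [h.setDim_image_flat hA hS.family.definable_params, hS.rank_eq]
  have hX : setDim L (range (flat : (Fin 2 → M) → Fin 2 × Fin d → K)) = 2 * setDim L M := by
    rw [← image_univ, h.setDim_image_flat hA definable_univ,
      hS.setDim_univ h.isSaturatedGeometric hA]
  have h1 := hS.tupleDim_flat_eq h hA ht htd
  have h2 := hS.tupleDim_flat_eq h hA hu hud
  exact ⟨⟨⟨x, rfl⟩, h1.1.trans hX.symm⟩,
    ⟨⟨t, (hS.family.subset x t ht).2, rfl⟩, h1.2.1.trans hT.symm⟩,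
    ⟨⟨u, (hS.family.subset x u hu).2, rfl⟩, h2.2.1.trans hT.symm⟩,
    hS.isGeneric_flatGraph h hA ht htd, hS.isGeneric_flatGraph h hA hu hud⟩

theorem isDefinableFamily_flatGraph (hS : IsStandardFamily L' A T C)
    (h : IsMinimalRelic L A₀ M L') :
    IsDefinableFamily L (A₀ ∪ coords A) (range (flat : (Fin 2 → M) → Fin 2 × Fin d → K))
      (flat '' T) (flatGraph C) := by
  refine ⟨h.relic.definable_image_flat hS.family.definable_params,
    h.relic.definable_flatGraph hS.family.definable_graph, ?_⟩
  rintro y s ⟨x, t, hC, he⟩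
  have h1 : y = flat x := funext fun i => congrFun he (Sum.inl i)
  have h2 : s = flat t := funext fun i => congrFun he (Sum.inr i)
  rw [h1, h2]
  exact ⟨⟨x, rfl⟩, t, (hS.family.subset x t hC).2, rfl⟩

/-- Two generic points of the graph over the same `x` with parameters independent over `x` form a
strongly generic intersection. -/
theorem isStronglyGeneric (hS : IsStandardFamily L' A T C) (h : IsMinimalRelic L A₀ M L')
    (hA : A.Countable) (ht : Sum.elim x t ∈ C) (hu : Sum.elim x u ∈ C)
    (htd : tupleDim L (A₀ ∪ coords A) (Sum.elim (flat x) (flat t)) = 3 * setDim L M)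
    (hud : tupleDim L (A₀ ∪ coords A ∪ range (flat x) ∪ range (flat t)) (flat u) = setDim L M) :
    IsStronglyGeneric L (A₀ ∪ coords A) (range (flat : (Fin 2 → M) → Fin 2 × Fin d → K))
      (flat '' T) (flat '' T) (flatGraph C) (flatGraph C) (flat x) (flat t) (flat u) := by
  have hE := h.exchange
  have hM := h.isSaturatedGeometric
  obtain ⟨h1, h2, h3, -⟩ := hS.tupleDim_flat_eq h hA ht htd
  have hux : tupleDim L (A₀ ∪ coords A ∪ range (flat x)) (flat u) = setDim L M :=
    le_antisymm (hS.tupleDim_flat_param_le h hA hu)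
      (hud.ge.trans (tupleDim_mono hE (subset_union_left.trans (subset_acl _)) _))
  have hxu : tupleDim L (A₀ ∪ coords A) (Sum.elim (flat x) (flat u)) = 3 * setDim L M := by
    rw [tupleDim_sumElim' hE, h1, hux]
    ring
  obtain ⟨-, hu2, -, -⟩ := hS.tupleDim_flat_eq h hA hu hxu
  have htux : tupleDim L (A₀ ∪ coords A ∪ range (flat x)) (flat (Sum.elim t u)) =
      2 * setDim L M := by
    rw [tupleDim_congr hE (range_flat_sumElim t u), tupleDim_sumElim' hE, h3, hud]
    ring
  have hrk : 2 ≤ tupleDim L' (A ∪ range x) (Sum.elim t u) := by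
    refine Nat.le_of_mul_le_mul_right ?_ h.one_le_setDim
    rw [← htux, ← union_coords_union_range]
    exact h.tupleDim_flat_le _ _
  have hacl := h.relic.range_flat_subset_acl (hS.range_subset_acl hM hA ht hu hrk)
  rw [union_coords_union_range] at hacl
  -- The point contributes 2δ and the parameters 2δ over it, so dim(tu/A) ≥ 4δ; since dim(u/A) = 2δ,
  -- t keeps its full dimension 2δ over Au.
  have h4 := tupleDim_add_le_of_range_subset_acl hE hacl
  rw [h1, htux, IsMinimalRelic.tupleDim_flat_sumElim hE, hu2] at h4
  have h5 : tupleDim L (A₀ ∪ coords A ∪ range (flat u)) (flat t) ≤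
      tupleDim L (A₀ ∪ coords A) (flat t) :=
    tupleDim_mono hE (subset_union_left.trans (subset_acl _)) _
  have h6 := IsMinimalRelic.tupleDim_flat_sumElim hE (A₀ ∪ coords A ∪ range (flat x)) t u
  refine ⟨hS.isWeaklyGeneric h hA ht hu htd hxu, ?_, ?_⟩
  · rw [Independent]
    omega
  · rw [Independent]
    omega

/-- In a relic of dimension at least `2`, the parameters of a weakly generic intersection of
codimension at most `1` are independent. -/
theorem independent_of_codim_le_one (hS : IsStandardFamily L' A T C)
    (h : IsMinimalRelic L A₀ M L') (hA : A.Countable) (hdim : 2 ≤ setDim L M)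
    (hw : IsWeaklyGeneric L (A₀ ∪ coords A) (range (flat : (Fin 2 → M) → Fin 2 × Fin d → K))
      (flat '' T) (flat '' T) (flatGraph C) (flatGraph C) (flat x) (flat t) (flat u))
    (hcodim : codim L (A₀ ∪ coords A) (flat x) (flat t) (flat u) ≤ 1) :
    Independent L' A t u := by
  have hE := h.exchange
  have hM := h.isSaturatedGeometric
  have ht := sumElim_flat_mem_flatGraph_iff.1 hw.left.1
  have hu := sumElim_flat_mem_flatGraph_iff.1 hw.right.1
  obtain ⟨h1, -, h3, -⟩ := hS.tupleDim_flat_eq h hA ht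
    (hw.left.2.trans (hS.setDim_flatGraph h hA))
  obtain ⟨-, -, h4, -⟩ := hS.tupleDim_flat_eq h hA hu
    (hw.right.2.trans (hS.setDim_flatGraph h hA))
  rw [codim, h3, h4, ← tupleDim_congr hE (range_flat_sumElim t u),
    ← union_coords_union_range] at hcodim
  have hle := h.tupleDim_flat_le (A ∪ range x) (Sum.elim t u)
  -- Codimension at most 1 means dim(tu/Ax) ≥ 2δ - 1, while rank at most 1 would give dim(tu/Ax) ≤
  -- δ. This is where δ ≥ 2 enters.
  have hrk : 2 ≤ tupleDim L' (A ∪ range x) (Sum.elim t u) := by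
    by_contra! hlt
    have := hle.trans (Nat.mul_le_mul_right (setDim L M) (Nat.le_of_lt_succ hlt))
    omega
  have hrkx : 2 ≤ tupleDim L' A x := by
    refine Nat.le_of_mul_le_mul_right ?_ h.one_le_setDim
    rw [← h1]
    exact h.tupleDim_flat_le _ _
  -- The pair (t, u) has rank at least 2 + 2 over A, the largest rank possible for two points of the
  -- plane.
  have h5 := tupleDim_add_le_of_range_subset_acl hM.exchange
    (hS.range_subset_acl hM hA ht hu hrk)
  rw [tupleDim_sumElim hM.exchange A] at h5
  have h6 := tupleDim_le_natCard hM.exchange A u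
  have h7 := tupleDim_le_natCard hM.exchange A t
  have h8 : tupleDim L' (A ∪ range u) t ≤ tupleDim L' A t :=
    tupleDim_mono hM.exchange (subset_union_left.trans (subset_acl _)) t
  rw [Nat.card_fin] at h6 h7
  rw [Independent]
  omega

variable [TopologicalSpace K]

/-- The diagonal point of a generic point of the graph is a multiple intersection. -/
theorem isGenericMultiple_diagonal (hK : IsHausdorffGeometric L K)
    (hS : IsStandardFamily L' A T C) (h : IsMinimalRelic L A₀ M L') (hA : A.Countable)
    (ht : Sum.elim x t ∈ C)
    (htd : tupleDim L (A₀ ∪ coords A) (Sum.elim (flat x) (flat t)) = 3 * setDim L M) :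
    IsGenericMultiple L (A₀ ∪ coords A) (range (flat : (Fin 2 → M) → Fin 2 × Fin d → K))
      (flat '' T) (flat '' T) (flatGraph C) (flatGraph C) (flat x) (flat t) (flat t) := by
  have hgraph := sumElim_flat_mem_flatGraph_iff.2 ht
  refine ⟨hS.isWeaklyGeneric h hA ht ht htd htd, ⟨hgraph, hgraph⟩, ?_⟩
  obtain ⟨-, -, -, h4⟩ := hS.tupleDim_flat_eq h hA ht htd
  have htT := (hS.family.subset x t ht).2
  have hd := definable_fiber hS.family.definable_graph t
  have hdf := h.relic.definable_image_flat hd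
  have hsd := h.setDim_image_flat (hA.union (countable_range t)) hd
  rw [hS.curve t htT, one_mul] at hsd
  rw [union_coords_union_range] at hdf
  have hB := (h.countable_union hA).union (countable_range (flat t))
  rw [mem_closure_iff_nhds]
  intro W hW
  let g : (Fin 2 × Fin d → K) → ((Fin 2 × Fin d → K) × (Fin 2 × Fin d → K) ×
      (Fin 2 × Fin d → K)) × ((Fin 2 × Fin d → K) × (Fin 2 × Fin d → K) × (Fin 2 × Fin d → K)) :=
    fun y => ((flat x, flat t, flat t), (y, flat t, flat t))
  have hg : Continuous g := by fun_prop
  -- Only the point moves: x is generic in C_t, so near x there is a point of C_t generic over x as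
  -- well, hence different from x.
  obtain ⟨b, hbW, hb, hbd⟩ := hK.baire _ _ (A₀ ∪ coords A ∪ range (flat t) ∪ range (flat x)) _
    (flat x) hB (hB.union (countable_range _)) subset_union_left hdf
    ⟨⟨x, ht, rfl⟩, h4.trans hsd.symm⟩ (g ⁻¹' W) (hg.continuousAt hW)
  refine ⟨g b, hbW, ⟨hgraph, hgraph⟩, ?_, ?_, rfl⟩
  · obtain ⟨y, hy, rfl⟩ := hb
    exact ⟨sumElim_flat_mem_flatGraph_iff.2 hy, sumElim_flat_mem_flatGraph_iff.2 hy⟩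
  · intro he
    have hbx : flat x = b := congrArg Prod.fst he
    have h0 : tupleDim L (A₀ ∪ coords A ∪ range (flat t) ∪ range (flat x)) b = 0 := by
      rw [tupleDim_eq_zero_iff h.exchange, hbx]
      exact subset_union_right.trans (subset_acl _)
    have := h.one_le_setDim
    omega

/-- Only the second parameter moves, among curves through x. The set of these parameters has
dimension exactly that of `M`, so t is generic in it and has nearby members that are generic over t
too. -/
theorem isStronglyApproximable_diagonal (hK : IsHausdorffGeometric L K)
    (hS : IsStandardFamily L' A T C) (h : IsMinimalRelic L A₀ M L') (hA : A.Countable)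
    (ht : Sum.elim x t ∈ C)
    (htd : tupleDim L (A₀ ∪ coords A) (Sum.elim (flat x) (flat t)) = 3 * setDim L M) :
    IsStronglyApproximable L (A₀ ∪ coords A) (range (flat : (Fin 2 → M) → Fin 2 × Fin d → K))
      (flat '' T) (flat '' T) (flatGraph C) (flatGraph C) (flat x) (flat t) (flat t) := by
  refine ⟨hS.isWeaklyGeneric h hA ht ht htd htd, fun W hW => ?_⟩
  obtain ⟨-, -, h3, -⟩ := hS.tupleDim_flat_eq h hA ht htd
  have hd := definable_params_through hS.family.definable_graph x
  have hdf := h.relic.definable_image_flat hd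
  have hsd := h.setDim_image_flat (hA.union (countable_range x)) hd
  rw [union_coords_union_range] at hdf
  have hB := (h.countable_union hA).union (countable_range (flat x))
  have hsd' : setDim L (flat '' {t | Sum.elim x t ∈ C}) = setDim L M := by
    refine le_antisymm ?_ (h3.ge.trans (h.geometric.tupleDim_le_setDim hB hdf ⟨t, ht, rfl⟩))
    rw [hsd]
    simpa using Nat.mul_le_mul_right (setDim L M) (Nat.le_of_lt_succ (hS.rank_through x))
  let g : (Fin 2 × Fin d → K) →
      (Fin 2 × Fin d → K) × (Fin 2 × Fin d → K) × (Fin 2 × Fin d → K) :=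
    fun u => (flat x, flat t, u)
  have hg : Continuous g := by fun_prop
  obtain ⟨b, hbW, ⟨u, hu, rfl⟩, hbd⟩ := hK.baire _ _
    (A₀ ∪ coords A ∪ range (flat x) ∪ range (flat t)) _ (flat t) hB
    (hB.union (countable_range _)) subset_union_left hdf ⟨⟨t, ht, rfl⟩, h3.trans hsd'.symm⟩
    (g ⁻¹' W) (hg.continuousAt hW)
  exact ⟨g (flat u), hbW, hS.isStronglyGeneric h hA ht hu htd (hbd.trans hsd')⟩

end Ambient

end IsStandardFamily

end ModelDim

/-! ### The contradiction when the relic has dimension at least 2 -/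

theorem theoremT {L : FirstOrder.Language.{u, v}} {K : Type w} [L.Structure K] [TopologicalSpace K]
    (hK : ModelDim.IsHausdorffGeometric L K)
    {A₀ : Set K} (hA₀ : A₀.Countable)
    {d : ℕ} {M : Set (Fin d → K)} {L' : FirstOrder.Language.{u', v'}} [L'.Structure M]
    (hrelic : ModelDim.IsDefinableRelic L A₀ M L')
    (hsm : ModelDim.IsStronglyMinimal L' M)
    (hnlm : ModelDim.IsNonLocallyModular L' M)
    (hdetect : ModelDim.DetectsMultipleIntersections L A₀ M L')
    (hpurity : ModelDim.HasRamificationPurity L K) :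
    ModelDim.setDim L M = 1 := by
  have h : ModelDim.IsMinimalRelic L A₀ M L' :=
    ⟨hK.isSaturatedGeometric, hA₀, hrelic, hsm.isMinimal⟩
  refine le_antisymm ?_ h.one_le_setDim
  by_contra! hdim
  obtain ⟨A, T, C, hA, hS⟩ := hnlm.exists_isStandardFamily h.isSaturatedGeometric h.minimal
  have hfam := hS.isDefinableFamily_flatGraph h
  have hB := h.countable_union hA
  have hdimC := hS.setDim_flatGraph h hA
  have hne : (ModelDim.flatGraph C).Nonempty := by
    by_contra hne
    rw [not_nonempty_iff_eq_empty.1 hne, ModelDim.IsSaturatedGeometric.setDim_empty] at hdimC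
    omega
  obtain ⟨_, ⟨x, t, ht, rfl⟩, htd⟩ := h.geometric.exists_isGeneric hB hfam.definable_graph hne
  rw [hdimC] at htd
  -- Both families are C, and purity is fed the diagonal point (x, t, t).
  obtain ⟨x', t', u', hmult, hcodim⟩ := hpurity _ _ _ _ _ _ _ _ _ hB
    (by rw [← image_univ]; exact hrelic.definable_image_flat definable_univ) hfam hfam
    ⟨_, _, _, hS.isGenericMultiple_diagonal hK h hA ht htd,
      hS.isStronglyApproximable_diagonal hK h hA ht htd⟩
  obtain ⟨x, rfl⟩ := hmult.1.point.1
  obtain ⟨t, -, rfl⟩ := hmult.1.left_param.1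
  obtain ⟨u, -, rfl⟩ := hmult.1.right_param.1
  exact hdetect A 2 2 T T C C hA hS hS x t u hmult
    (hS.independent_of_codim_le_one h hA hdim hmult.1 hcodim)
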